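/- \textbf{Setting.} Let $p,q\in\mathbb N$, let $\Theta\subset\mathbb R^p$ and $\Theta'\subset\mathbb R^q$ be compact with positive Lebesgue measure, and let $T>0$. Let $\mathbb G\in\mathbb R^{N_h\times N_h}$ be symmetric positive definite, $\|x\|:=\sqrt{x^T\mathbb Gx}$, and let $(\mu,\nu,t)\mapsto u^{\mu,\nu,t}\in\mathbb R^{N_h}$ be the parameter-to-solution map on $\Theta\times\Theta'\times[0,T]$. Assume that it is $L$-Lipschitz, $\|u^{\mu,\nu,t}-u^{\mu',\nu',t'}\|\le L(|\mu-\mu'|+|\nu-\nu'|+|t-t'|)$, and that $m:=\operatorname{ess\,inf}\|u^{\mu,\nu,t}\|>0$. Let $0<\varepsilon<1$ and $0<\delta<1$. Let $\nu_1,\dots,\nu_{N_{s_2}}$ be independent and uniformly distributed in $\Theta'$, with joint law $\mathbb P_\nu$. Take $N_A=N_h$ and let $\mathbb A\in\mathbb R^{N_h\times N_A}$ be $\mathbb G$-orthonormal, i.e. $\mathbb A^T\mathbb G\mathbb A=I$; it may depend on the sample (for instance, a POD matrix of the snapshots). For $(\mu,t)\in\Theta\times[0,T]$ let $\sigma(\mu,t)_1^2\ge\dots\ge\sigma(\mu,t)_{N_A}^2$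 be the eigenvalues of $\frac{|\Theta'|}{N_{s_2}}\sum_i w_iw_i^T$ with $w_i=\mathbb A^T\mathbb Gu^{\mu,\nu_i,t}$, and let $N'$ be the least $n\ge 0$ with $$\sup_{(\mu,t)\in\Theta\times[0,T]}\ \sum_{k>n}\sigma(\mu,t)_k^2\le\frac{m^2\varepsilon^2}{16\,|\Theta\times[0,T]|}.$$ So $N'$ depends on the sample. An \emph{optimal DOD} for the sample is a map $s:\Theta\times[0,T]\to[-1,1]^{N_A\times N'}$ such that, for every $(\mu,t)$, $\mathbb As(\mu,t)$ is $\mathbb G$-orthonormal and $s(\mu,t)$ minimizes $W\mapsto J(\mu,t,\mathbb AW)$ over $[-1,1]^{N_A\times N'}$, where $J(\mu,t,V)=\frac{|\Theta'|}{N_{s_2}}\sum_i\|u^{\mu,\nu_i,t}-VV^T\mathbb Gu^{\mu,\nu_i,t}\|^2$. Neural networks are ReLU networks in which every layer may read all previous layers, with affine last layer; an architecture fixes the layer widths and the positions of the nonzero (active) weights. An \emph{inner DOD module} with architecture $\Phi_{\tilde{\mathbb V}}$ consists of a seed network on $\mathbb R^{p+1}$ followed by $N'$ parallel root networks with outputs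 in $\mathbb R^{N_A}$; the outputs are stacked as the columns of an $N_A\times N'$ matrix, and the columns are orthonormalized by the Gram--Schmidt process. Write $\tilde{\mathbb V}_{\mu,t}$ for its value at $(\mu,t)$ and $\mathbb V_{\mu,t}=\mathbb A\tilde{\mathbb V}_{\mu,t}$. With a network $\phi_{N'}:\mathbb R^{p+q+1}\to\mathbb R^{N'}$ of architecture $\Phi_{N'}$, the DOD+DFNN approximation is $\hat u^{\mu,\nu,t}=\mathbb V_{\mu,t}\,\phi_{N'}(\mu,\nu,t)$, and its relative error is $$\mathcal E_R=\Big(\int_{\Theta\times\Theta'\times[0,T]}\frac{\|u^{\mu,\nu,t}-\hat u^{\mu,\nu,t}\|^2}{\|u^{\mu,\nu,t}\|^2}\,d(\mu,\nu,t)\Big)^{1/2}.$$ \textbf{Theorem.} Fix $\hat L>0$ and $\varepsilon_0\in(0,1)$. There is a constant $c>0$ depending only on $\Theta,\Theta',T,L,\hat L,p,q,N',m,\varepsilon_0$ (in particular not on $N_h$, $\mathbb G$, $\varepsilon$, $\delta$ or the sample) such that for all $\varepsilon\in(0,\varepsilon_0]$ and $\delta\in(0,1)$ there are a number $N_0$ and,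 for each value of $N'$, architectures $\Phi_{\tilde{\mathbb V}}$ and $\Phi_{N'}$ with the following properties. The complexities are at most \begin{itemize} \item $c\log(\varepsilon^{-1})$ layers and $c\,N_AN'\varepsilon^{-(p+1)}\log(\varepsilon^{-1})$ active weights for the inner DOD module $\Phi_{\tilde{\mathbb V}}$, \item $c\log(\varepsilon^{-1})$ layers and $c\,N'\varepsilon^{-(p+q+1)}\log(\varepsilon^{-1})$ active weights for the coefficient network $\Phi_{N'}$. \end{itemize} For every sample size $N_{s_2}\ge N_0$, if almost every sample has an optimal DOD that is $\hat L$-Lipschitz (for the Euclidean matrix norm and the distance $|\mu-\mu'|+|t-t'|$), then for a suitable, sample-dependent choice of the weights of these architectures, $\mathbb V_{\mu,t}$ is $\mathbb G$-orthonormal for all $(\mu,t)\in\Theta\times[0,T]$ and $$\mathbb P_\nu\big[\mathcal E_R<\varepsilon\big]>1-\delta .$$ The last assertion means that both properties hold for all samples in a measurable set of probability greater than $1-\delta$. -/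

import Mathlib

open Set MeasureTheory
open scoped Matrix ENNReal

namespace DODROM

/-! ## Neural networks with skip connections and ReLU activation -/

/-- A network architecture with input dimension `d` and output dimension `m`: the number of layers
`depth`, the layer widths `N_0 = d, N_1, …, N_depth = m`, and the positions of the active entries
(the masks) of the matrices `A_l` and of the vectors `b_l`, for `1 ≤ l ≤ depth`.
The matrix `A_l`, of size `N_l × (N_0 + ⋯ + N_(l-1))`, is kept as its blocks
`A_l = [A_(l,0) | ⋯ | A_(l,l-1)]`, so that `maskA l k` is the mask of the block acting on the output
of layer `k`. Only the data with `k < l ≤ depth` are ever used. -/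
structure Architecture (d m : ℕ) where
  depth : ℕ
  depth_pos : 0 < depth
  width : ℕ → ℕ
  width_zero : width 0 = d
  width_depth : width depth = m
  width_pos : ∀ l, 0 < l → l < depth → 0 < width l
  maskA : (l k : ℕ) → Finset (Fin (width l) × Fin (width k))
  maskb : (l : ℕ) → Finset (Fin (width l))

/-- The number of active weights: the number of nonzero entries of all `A_l` and `b_l`. -/
def Architecture.activeWeights {d m : ℕ} (a : Architecture d m) : ℕ :=
  ∑ l ∈ Finset.Icc 1 a.depth,
    ((∑ k ∈ Finset.range l, (a.maskA l k).card) + (a.maskb l).card)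

/-- The admissible weights of an architecture: one real number for each active entry. -/
structure Architecture.Weights {d m : ℕ} (a : Architecture d m) where
  wA : (l k : ℕ) → {x // x ∈ a.maskA l k} → ℝ
  wb : (l : ℕ) → {x // x ∈ a.maskb l} → ℝ

/-- The block `A_(l,k)` obtained from the weights, extended by zero off the mask. -/
def Architecture.Weights.A {d m : ℕ} {a : Architecture d m} (θ : a.Weights) (l k : ℕ) :
    Matrix (Fin (a.width l)) (Fin (a.width k)) ℝ :=
  Matrix.of fun i j => if h : (i, j) ∈ a.maskA l k then θ.wA l k ⟨(i, j), h⟩ else 0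

/-- The vector `b_l` obtained from the weights, extended by zero off the mask. -/
def Architecture.Weights.b {d m : ℕ} {a : Architecture d m} (θ : a.Weights) (l : ℕ) :
    Fin (a.width l) → ℝ :=
  fun i => if h : i ∈ a.maskb l then θ.wb l ⟨i, h⟩ else 0

/-- The ReLU activation function. -/
noncomputable def relu (x : ℝ) : ℝ := max x 0

/-- The output of layer `l` on the input `x`: the layers `1 ≤ l < depth` apply the activation
function to an affine map of all previous layers, the layer `depth` is affine. -/
noncomputable def Architecture.Weights.layer {d m : ℕ} {a : Architecture d m} (θ : a.Weights)
    (x : Fin d → ℝ) : (l : ℕ) → Fin (a.width l) → ℝ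
  | 0 => fun i => x (Fin.cast a.width_zero i)
  | l + 1 =>
    let z : Fin (a.width (l + 1)) → ℝ :=
      (∑ k : Fin (l + 1), θ.A (l + 1) k *ᵥ Architecture.Weights.layer θ x k) + θ.b (l + 1)
    if l + 1 < a.depth then fun i => relu (z i) else z
  termination_by l => l
  decreasing_by exact k.2

/-- The realization `ℝ^d → ℝ^m` of a network. -/
noncomputable def Architecture.Weights.realize {d m : ℕ} {a : Architecture d m} (θ : a.Weights)
    (x : Fin d → ℝ) : Fin m → ℝ :=
  fun i => θ.layer x a.depth (Fin.cast a.width_depth.symm i)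

/-! ## The inner module of the deep orthogonal decomposition (DOD) -/

/-- The orthonormalization unit: Gram-Schmidt (that is, the `Q` factor of a QR decomposition)
applied to the columns of `W`. It preserves the span of the columns, and its columns are orthonormal
if those of `W` are linearly independent. -/
noncomputable def orth {NA n : ℕ} (W : Matrix (Fin NA) (Fin n) ℝ) : Matrix (Fin NA) (Fin n) ℝ :=
  Matrix.of fun i j =>
    InnerProductSpace.gramSchmidtNormed ℝ
      (fun k : Fin n => (WithLp.toLp 2 (fun r => W r k) : EuclideanSpace ℝ (Fin NA))) j i

/-- The architecture of the trainable part of an inner DOD module, the parallelization of the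
concatenations `R_1 ⊙ s, …, R_n ⊙ s` of a seed network `s : ℝ^d → ℝ^ℓ` with root networks
`R_j : ℝ^ℓ → ℝ^NA`. -/
structure DODArchitecture (d NA n : ℕ) where
  seedDim : ℕ
  seed : Architecture d seedDim
  root : Fin n → Architecture seedDim NA

/-- A concatenation has as many layers as its parts together, and a parallelization has as many
layers as its deepest branch. -/
def DODArchitecture.layers {d NA n : ℕ} (a : DODArchitecture d NA n) : ℕ :=
  a.seed.depth + Finset.univ.sup fun j => (a.root j).depth

/-- The weights of all parallel branches. The factor `2` covers the sparse concatenation of ReLU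
networks through `x = relu x - relu (-x)`, which at most doubles the number of nonzero entries. -/
def DODArchitecture.activeWeights {d NA n : ℕ} (a : DODArchitecture d NA n) : ℕ :=
  ∑ j, 2 * (a.seed.activeWeights + (a.root j).activeWeights)

structure DODArchitecture.Weights {d NA n : ℕ} (a : DODArchitecture d NA n) where
  seed : a.seed.Weights
  root : (j : Fin n) → (a.root j).Weights

/-- The realization of the inner DOD module: the outputs of the `n` branches are stacked as the
columns of a matrix, which is then orthonormalized. -/
noncomputable def DODArchitecture.Weights.realize {d NA n : ℕ} {a : DODArchitecture d NA n}
    (θ : a.Weights) (x : Fin d → ℝ) : Matrix (Fin NA) (Fin n) ℝ :=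
  orth (Matrix.of fun i j => (θ.root j).realize (θ.seed.realize x) i)

/-! ## The parametric problem -/

/-- The norm `√(xᵀ G x)` induced by the mass matrix. -/
noncomputable def gNorm {Nh : ℕ} (G : Matrix (Fin Nh) (Fin Nh) ℝ) (x : Fin Nh → ℝ) : ℝ :=
  √(x ⬝ᵥ (G *ᵥ x))

def GOrthonormal {Nh n : ℕ} (G : Matrix (Fin Nh) (Fin Nh) ℝ) (V : Matrix (Fin Nh) (Fin n) ℝ) :
    Prop :=
  Vᵀ * G * V = 1

/-- The parameter-to-solution map `(μ, ν, t) ↦ u μ ν t` is `L`-Lipschitz on `Θ × Θ' × [0, T]`. -/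
def LipschitzSolution {p q Nh : ℕ} (Θ : Set (EuclideanSpace ℝ (Fin p)))
    (Θ' : Set (EuclideanSpace ℝ (Fin q))) (T : ℝ) (G : Matrix (Fin Nh) (Fin Nh) ℝ)
    (u : EuclideanSpace ℝ (Fin p) → EuclideanSpace ℝ (Fin q) → ℝ → Fin Nh → ℝ) (L : ℝ) : Prop :=
  ∀ μ₁ ∈ Θ, ∀ μ₂ ∈ Θ, ∀ ν₁ ∈ Θ', ∀ ν₂ ∈ Θ', ∀ t₁ ∈ Icc 0 T, ∀ t₂ ∈ Icc 0 T,
    gNorm G (u μ₁ ν₁ t₁ - u μ₂ ν₂ t₂) ≤ L * (‖μ₁ - μ₂‖ + ‖ν₁ - ν₂‖ + |t₁ - t₂|)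

/-- The essential infimum of `‖u μ ν t‖` over `Θ × Θ' × [0, T]`. -/
noncomputable def solutionEssInf {p q Nh : ℕ} (Θ : Set (EuclideanSpace ℝ (Fin p)))
    (Θ' : Set (EuclideanSpace ℝ (Fin q))) (T : ℝ) (G : Matrix (Fin Nh) (Fin Nh) ℝ)
    (u : EuclideanSpace ℝ (Fin p) → EuclideanSpace ℝ (Fin q) → ℝ → Fin Nh → ℝ) : ℝ :=
  essInf
    (fun x : EuclideanSpace ℝ (Fin p) × EuclideanSpace ℝ (Fin q) × ℝ =>
      gNorm G (u x.1 x.2.1 x.2.2))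
    (volume.restrict (Θ ×ˢ Θ' ×ˢ Icc 0 T))

/-- The law of `N` independent samples, uniformly distributed in `Θ'`. -/
noncomputable def sampleLaw {q : ℕ} (Θ' : Set (EuclideanSpace ℝ (Fin q))) (N : ℕ) :
    Measure (Fin N → EuclideanSpace ℝ (Fin q)) :=
  Measure.pi fun _ => ProbabilityTheory.cond volume Θ'

/-- The relative error `(∫ ‖u - û‖² / ‖u‖² d(μ, ν, t))^(1/2)` over `Θ × Θ' × [0, T]`. -/
noncomputable def relativeError {p q Nh : ℕ} (Θ : Set (EuclideanSpace ℝ (Fin p)))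
    (Θ' : Set (EuclideanSpace ℝ (Fin q))) (T : ℝ) (G : Matrix (Fin Nh) (Fin Nh) ℝ)
    (u uhat : EuclideanSpace ℝ (Fin p) → EuclideanSpace ℝ (Fin q) → ℝ → Fin Nh → ℝ) : ℝ≥0∞ :=
  (∫⁻ x : EuclideanSpace ℝ (Fin p) × EuclideanSpace ℝ (Fin q) × ℝ in Θ ×ˢ Θ' ×ˢ Icc 0 T,
    ENNReal.ofReal
      (gNorm G (u x.1 x.2.1 x.2.2 - uhat x.1 x.2.1 x.2.2) ^ 2
        / gNorm G (u x.1 x.2.1 x.2.2) ^ 2)) ^ (1 / 2 : ℝ)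

/-! ## The optimal DOD and the reduced dimension of a sample -/

/-- The objective DOD functional of the sample `ν 1, …, ν N`:
`|Θ'| / N * ∑ i, ‖u μ (ν i) t - V Vᵀ G u μ (ν i) t‖²`. -/
noncomputable def objective {p q Nh N n : ℕ} (Θ' : Set (EuclideanSpace ℝ (Fin q)))
    (G : Matrix (Fin Nh) (Fin Nh) ℝ)
    (u : EuclideanSpace ℝ (Fin p) → EuclideanSpace ℝ (Fin q) → ℝ → Fin Nh → ℝ)
    (ν : Fin N → EuclideanSpace ℝ (Fin q)) (μ : EuclideanSpace ℝ (Fin p)) (t : ℝ)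
    (V : Matrix (Fin Nh) (Fin n) ℝ) : ℝ :=
  volume.real Θ' / N *
    ∑ i, gNorm G (u μ (ν i) t - (V * Vᵀ * G) *ᵥ u μ (ν i) t) ^ 2

/-- `s` is an optimal DOD of dimension `n` for the sample `ν`: for all `(μ, t) ∈ Θ × [0, T]`, the
matrix `s μ t` minimizes `W ↦ objective (A W)` over the matrices `W` with entries in `[-1, 1]`, and
`A * s μ t` is orthonormal with respect to `G`. -/
def IsOptimalDOD {p q Nh NA N n : ℕ} (Θ : Set (EuclideanSpace ℝ (Fin p)))
    (Θ' : Set (EuclideanSpace ℝ (Fin q))) (T : ℝ) (G : Matrix (Fin Nh) (Fin Nh) ℝ)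
    (u : EuclideanSpace ℝ (Fin p) → EuclideanSpace ℝ (Fin q) → ℝ → Fin Nh → ℝ)
    (A : Matrix (Fin Nh) (Fin NA) ℝ) (ν : Fin N → EuclideanSpace ℝ (Fin q))
    (s : EuclideanSpace ℝ (Fin p) → ℝ → Matrix (Fin NA) (Fin n) ℝ) : Prop :=
  ∀ μ ∈ Θ, ∀ t ∈ Icc 0 T,
    (∀ i j, s μ t i j ∈ Icc (-1 : ℝ) 1) ∧
    GOrthonormal G (A * s μ t) ∧
    ∀ W : Matrix (Fin NA) (Fin n) ℝ, (∀ i j, W i j ∈ Icc (-1 : ℝ) 1) →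
      objective Θ' G u ν μ t (A * s μ t) ≤ objective Θ' G u ν μ t (A * W)

/-- A matrix-valued map is `K`-Lipschitz on `Θ × [0, T]`, for the Euclidean norm of matrices. -/
def LipschitzDOD {p NA n : ℕ} (Θ : Set (EuclideanSpace ℝ (Fin p))) (T : ℝ)
    (s : EuclideanSpace ℝ (Fin p) → ℝ → Matrix (Fin NA) (Fin n) ℝ) (K : ℝ) : Prop :=
  ∀ μ₁ ∈ Θ, ∀ μ₂ ∈ Θ, ∀ t₁ ∈ Icc 0 T, ∀ t₂ ∈ Icc 0 T,
    √(∑ i, ∑ j, (s μ₁ t₁ i j - s μ₂ t₂ i j) ^ 2) ≤ K * (‖μ₁ - μ₂‖ + |t₁ - t₂|)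

/-- The matrix whose columns are the pre-reduced snapshots `Aᵀ G u μ (ν i) t`. -/
noncomputable def snapshots {p q Nh NA N : ℕ} (G : Matrix (Fin Nh) (Fin Nh) ℝ)
    (u : EuclideanSpace ℝ (Fin p) → EuclideanSpace ℝ (Fin q) → ℝ → Fin Nh → ℝ)
    (A : Matrix (Fin Nh) (Fin NA) ℝ) (ν : Fin N → EuclideanSpace ℝ (Fin q))
    (μ : EuclideanSpace ℝ (Fin p)) (t : ℝ) : Matrix (Fin NA) (Fin N) ℝ :=
  Matrix.of fun k i => ((Aᵀ * G) *ᵥ u μ (ν i) t) k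

/-- The discrete correlation matrix of the pre-reduced snapshots for fixed `(μ, t)`. -/
noncomputable def correlation {p q Nh NA N : ℕ} (Θ' : Set (EuclideanSpace ℝ (Fin q)))
    (G : Matrix (Fin Nh) (Fin Nh) ℝ)
    (u : EuclideanSpace ℝ (Fin p) → EuclideanSpace ℝ (Fin q) → ℝ → Fin Nh → ℝ)
    (A : Matrix (Fin Nh) (Fin NA) ℝ) (ν : Fin N → EuclideanSpace ℝ (Fin q))
    (μ : EuclideanSpace ℝ (Fin p)) (t : ℝ) : Matrix (Fin NA) (Fin NA) ℝ :=
  (volume.real Θ' / N) • (snapshots G u A ν μ t * (snapshots G u A ν μ t)ᵀ)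

theorem correlation_isHermitian {p q Nh NA N : ℕ} (Θ' : Set (EuclideanSpace ℝ (Fin q)))
    (G : Matrix (Fin Nh) (Fin Nh) ℝ)
    (u : EuclideanSpace ℝ (Fin p) → EuclideanSpace ℝ (Fin q) → ℝ → Fin Nh → ℝ)
    (A : Matrix (Fin Nh) (Fin NA) ℝ) (ν : Fin N → EuclideanSpace ℝ (Fin q))
    (μ : EuclideanSpace ℝ (Fin p)) (t : ℝ) : (correlation Θ' G u A ν μ t).IsHermitian := by
  unfold correlation Matrix.IsHermitian
  rw [Matrix.conjTranspose_eq_transpose_of_trivial, Matrix.transpose_smul, Matrix.transpose_mul,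
    Matrix.transpose_transpose]

/-- The sum of all but the `n` largest eigenvalues of the correlation matrix (the function
`eigenvalues₀` lists the eigenvalues in decreasing order, starting from index `0`). -/
noncomputable def eigenvalueTail {p q Nh NA N : ℕ} (Θ' : Set (EuclideanSpace ℝ (Fin q)))
    (G : Matrix (Fin Nh) (Fin Nh) ℝ)
    (u : EuclideanSpace ℝ (Fin p) → EuclideanSpace ℝ (Fin q) → ℝ → Fin Nh → ℝ)
    (A : Matrix (Fin Nh) (Fin NA) ℝ) (ν : Fin N → EuclideanSpace ℝ (Fin q))
    (μ : EuclideanSpace ℝ (Fin p)) (t : ℝ) (n : ℕ) : ℝ :=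
  ∑ k : Fin (Fintype.card (Fin NA)),
    if n ≤ (k : ℕ) then (correlation_isHermitian Θ' G u A ν μ t).eigenvalues₀ k else 0

/-- The reduced dimension `N'` of the sample `ν` at precision `ε`: the least `n` such that
`sup_(μ, t) ∑_(k > n) σ(μ, t)_k² ≤ m² ε² / (16 |Θ × [0, T]|)`. -/
noncomputable def reducedDim {p q Nh NA N : ℕ} (Θ : Set (EuclideanSpace ℝ (Fin p)))
    (Θ' : Set (EuclideanSpace ℝ (Fin q))) (T : ℝ) (G : Matrix (Fin Nh) (Fin Nh) ℝ)
    (u : EuclideanSpace ℝ (Fin p) → EuclideanSpace ℝ (Fin q) → ℝ → Fin Nh → ℝ)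
    (A : Matrix (Fin Nh) (Fin NA) ℝ) (ν : Fin N → EuclideanSpace ℝ (Fin q)) (ε : ℝ) : ℕ :=
  sInf {n : ℕ | ∀ μ ∈ Θ, ∀ t ∈ Icc 0 T,
    eigenvalueTail Θ' G u A ν μ t n
      ≤ solutionEssInf Θ Θ' T G u ^ 2 / (16 * (volume.real Θ * T)) * ε ^ 2}

/-- The DOD+DFNN approximation `û = A Ṽ_(μ,t) φ(μ, ν, t)` of the parameter-to-solution map. -/
noncomputable def dodDfnn {p q Nh NA n : ℕ} (A : Matrix (Fin Nh) (Fin NA) ℝ)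
    {a : DODArchitecture (p + 1) NA n} (θ : a.Weights)
    {b : Architecture (p + q + 1) n} (η : b.Weights)
    (μ : EuclideanSpace ℝ (Fin p)) (ν : EuclideanSpace ℝ (Fin q)) (t : ℝ) : Fin Nh → ℝ :=
  (A * θ.realize (Fin.append μ ![t])) *ᵥ η.realize (Fin.append (Fin.append μ ν) ![t])

end DODROM

/-!
The error of the approximation `û = A Ṽ φ` splits, in the coordinates `w = Aᵀ G u` and hence in a
Euclidean norm, into the projection error of the optimal DOD and the errors of the two networks.

*Networks.* Both networks come from one construction, `exists_architecture_lipschitz`. On a lattice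
of mesh `h`, the bumps `x ↦ relu (d + 1 - ∑ i, |x i / h - z i|)` are turned into a partition of
unity by truncating their partial sums at `1`; only the boundedly many bumps that overlap a given
one enter its partial sum, so that the hidden layers have `O(h⁻ᵈ)` active weights. The output layer
contains sampled values of the function to be approximated. The interpolation error is a convex
combination of vectors of norm `O(h)`, so it is `O(h)` in the Euclidean norm, whatever the output
dimension is.
The roots of the inner DOD module approximate the columns of the optimal DOD and its seed is the
identity; the coefficient network approximates the coefficients of `u` in the optimal DOD, which are
Lipschitz because the optimal DOD and `u` are. Mesh sizes proportional to `ε` give the stated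
complexities. The depth is constant, and `log ε⁻¹` is bounded below by `log ε₀⁻¹`.

*Orthonormalization.* Near an orthonormal family the Gram-Schmidt process is Lipschitz with a
constant that depends only on the number of vectors (`gramSchmidtNormed_stable`), so that the
orthonormalized columns exist and are still close to the optimal DOD.

*Projection error.* On the sample, an optimal DOD is at least as good as the principal components,
whose mean square error is the tail of the eigenvalues (`exists_principal_components`); by the
definition of the reduced dimension this tail is at most `m² ε² / (16 |Θ × [0, T]|)`. The squared
projection errors for all `(μ, t)` and all candidate bases are uniformly bounded and uniformly
Lipschitz in `ν`, so the uniform law of large numbers `exists_uniform_sample_bound` carries the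
bound over from the sample to the integral over `Θ'`, outside an event of probability less than `δ`.
-/

namespace DODROM

/-! ### Feed-forward networks -/

/-- Blocks and biases that vanish off the masks are realized by admissible weights. -/
theorem Architecture.exists_weights {d m : ℕ} (a : Architecture d m)
    (W : (l k : ℕ) → Matrix (Fin (a.width l)) (Fin (a.width k)) ℝ)
    (β : (l : ℕ) → Fin (a.width l) → ℝ)
    (hW : ∀ l k i j, W l k i j ≠ 0 → (i, j) ∈ a.maskA l k)
    (hβ : ∀ l i, β l i ≠ 0 → i ∈ a.maskb l) :
    ∃ θ : a.Weights, (∀ l k, θ.A l k = W l k) ∧ ∀ l, θ.b l = β l := by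
  refine ⟨⟨fun l k x => W l k x.1.1 x.1.2, fun l x => β l x.1⟩, fun l k => ?_, fun l => ?_⟩
  · ext i j
    simp only [Architecture.Weights.A, Matrix.of_apply]
    split_ifs with h
    · rfl
    · by_contra h'
      exact h (hW l k i j (Ne.symm h'))
  · ext i
    simp only [Architecture.Weights.b]
    split_ifs with h
    · rfl
    · by_contra h'
      exact h (hβ l i (Ne.symm h'))

/-- The entrywise ReLU. -/
noncomputable def reluVec {ι : Type*} (v : ι → ℝ) : ι → ℝ := fun i => relu (v i)

/-- The feed-forward architecture with `D` hidden layers of widths `w 1, …, w D`, without skip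
connections: `M l` is the mask of the block from layer `l` to layer `l + 1`. All biases of the
hidden layers are active, and the output layer has no bias. -/
abbrev ffArch (D : ℕ) (w : ℕ → ℕ) (hw : ∀ l, 0 < l → l < D + 1 → 0 < w l)
    (M : (l : ℕ) → Finset (Fin (w (l + 1)) × Fin (w l))) : Architecture (w 0) (w (D + 1)) where
  depth := D + 1
  depth_pos := D.succ_pos
  width := w
  width_zero := rfl
  width_depth := rfl
  width_pos := hw
  maskA l k := if h : l = k + 1 then h ▸ M k else ∅
  maskb l := if l < D + 1 then Finset.univ else ∅

theorem activeWeights_ffArch (D : ℕ) (w : ℕ → ℕ) (hw : ∀ l, 0 < l → l < D + 1 → 0 < w l)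
    (M : (l : ℕ) → Finset (Fin (w (l + 1)) × Fin (w l))) :
    (ffArch D w hw M).activeWeights =
      ∑ l ∈ Finset.range (D + 1), ((M l).card + if l < D then w (l + 1) else 0) := by
  have h : ∀ l, ∑ k ∈ Finset.range (l + 1), ((ffArch D w hw M).maskA (l + 1) k).card =
      (M l).card := by
    intro l
    rw [Finset.sum_eq_single_of_mem l (Finset.self_mem_range_succ l)]
    · simp [ffArch]
    · intro k _ hk
      have : ¬ l + 1 = k + 1 := by omega
      simp only [ffArch]
      rw [dif_neg this, Finset.card_empty]
  have hb : ∀ l, ((ffArch D w hw M).maskb (l + 1)).card = if l < D then w (l + 1) else 0 := by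
    intro l
    by_cases hl : l < D
    · have : l + 1 < D + 1 := by omega
      rw [if_pos hl]
      change (if l + 1 < D + 1 then (Finset.univ : Finset (Fin (w (l + 1)))) else ∅).card = _
      rw [if_pos this, Finset.card_fin]
    · have : ¬ l + 1 < D + 1 := by omega
      rw [if_neg hl]
      change (if l + 1 < D + 1 then (Finset.univ : Finset (Fin (w (l + 1)))) else ∅).card = _
      rw [if_neg this, Finset.card_empty]
  unfold Architecture.activeWeights
  have hD : (ffArch D w hw M).depth = D + 1 := rfl
  have hI : Finset.Icc 1 (D + 1) = (Finset.range (D + 1)).map (addRightEmbedding 1) := by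
    rw [Finset.range_eq_Ico, Finset.map_add_right_Ico]
    rfl
  rw [hD, hI, Finset.sum_map]
  refine Finset.sum_congr rfl fun l _ => ?_
  rw [← h l, ← hb l]
  rfl

/-- The output of the hidden layers of a feed-forward network. -/
noncomputable def ffLayer {w : ℕ → ℕ} (W : (l : ℕ) → Matrix (Fin (w (l + 1))) (Fin (w l)) ℝ)
    (β : (l : ℕ) → Fin (w l) → ℝ) (x : Fin (w 0) → ℝ) : (l : ℕ) → Fin (w l) → ℝ
  | 0 => x
  | l + 1 => reluVec (W l *ᵥ ffLayer W β x l + β (l + 1))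

theorem exists_weights_ffArch (D : ℕ) (w : ℕ → ℕ) (hw : ∀ l, 0 < l → l < D + 1 → 0 < w l)
    (M : (l : ℕ) → Finset (Fin (w (l + 1)) × Fin (w l)))
    (W : (l : ℕ) → Matrix (Fin (w (l + 1))) (Fin (w l)) ℝ) (β : (l : ℕ) → Fin (w l) → ℝ)
    (hW : ∀ l i j, W l i j ≠ 0 → (i, j) ∈ M l) :
    ∃ θ : (ffArch D w hw M).Weights, ∀ x, θ.realize x = W D *ᵥ ffLayer W β x D := by
  have hD : (ffArch D w hw M).depth = D + 1 := rfl
  obtain ⟨θ, hA, hb⟩ := (ffArch D w hw M).exists_weights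
    (fun l k => if h : l = k + 1 then h ▸ W k else (0 : Matrix (Fin (w l)) (Fin (w k)) ℝ))
    (fun l => if l < D + 1 then β l else 0)
    (by
      intro l k i j h
      by_cases hl : l = k + 1
      · subst hl
        simp only [ffArch, dite_true] at h ⊢
        exact hW k i j h
      · rw [dif_neg hl] at h
        exact absurd rfl h)
    (by
      intro l i h
      by_cases hl : l < D + 1
      · simp only [ffArch, if_pos hl]
        exact Finset.mem_univ _
      · simp [hl] at h)
  have hA₁ : ∀ l, θ.A (l + 1) l = W l := fun l => (hA (l + 1) l).trans (dif_pos rfl)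
  have hA₀ : ∀ l k, ¬ l = k + 1 → θ.A l k = 0 := fun l k h => (hA l k).trans (dif_neg h)
  have hb₁ : ∀ l, l < D + 1 → θ.b l = β l := fun l h => (hb l).trans (if_pos h)
  have hb₀ : θ.b (D + 1) = 0 := (hb (D + 1)).trans (if_neg (lt_irrefl _))
  have hz : ∀ x l, (∑ k : Fin (l + 1), θ.A (l + 1) k *ᵥ θ.layer x k) =
      θ.A (l + 1) l *ᵥ θ.layer x l := by
    intro x l
    refine (Finset.sum_eq_single_of_mem (Fin.last l) (Finset.mem_univ _) ?_).trans rfl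
    intro k _ hk
    have : ¬ l + 1 = (k : ℕ) + 1 := fun h => hk (Fin.ext (by simpa using h.symm))
    rw [hA₀ _ _ this]
    exact Matrix.zero_mulVec _
  have hl : ∀ x l, l < D + 1 → θ.layer x l = ffLayer W β x l := by
    intro x l
    induction l with
    | zero => intro _; rw [Architecture.Weights.layer]; rfl
    | succ l ih =>
      intro h
      rw [Architecture.Weights.layer, hD, if_pos h, hz, hb₁ _ h, ih (by omega), hA₁]
      rfl
  refine ⟨θ, fun x => ?_⟩
  have : θ.layer x (D + 1) = W D *ᵥ ffLayer W β x D := by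
    rw [Architecture.Weights.layer, hD, if_neg (lt_irrefl _), hz, hb₀, hl x D (by omega), hA₁]
    exact add_zero _
  exact this

theorem exists_idNetwork (d : ℕ) : ∃ a : Architecture d d, a.depth = 1 ∧ a.activeWeights = d ∧
    ∃ θ : a.Weights, ∀ x, θ.realize x = x := by
  refine ⟨ffArch 0 (fun _ => d) (by omega) (fun _ => Finset.univ.filter fun x => x.1 = x.2), rfl,
    ?_, ?_⟩
  · have : (Finset.univ.filter fun x : Fin d × Fin d => x.1 = x.2).card = d := by
      have : (Finset.univ.filter fun x : Fin d × Fin d => x.1 = x.2) =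
          Finset.univ.map ⟨fun i : Fin d => (i, i), fun i j h => (Prod.mk.inj h).1⟩ := by
        ext ⟨i, j⟩
        rw [Finset.mem_filter, Finset.mem_map]
        exact ⟨fun h => ⟨i, Finset.mem_univ _, Prod.ext rfl h.2⟩,
          fun ⟨a, _, h⟩ => ⟨Finset.mem_univ _, by
            obtain ⟨h₁, h₂⟩ := Prod.mk.inj h
            exact h₁.symm.trans h₂⟩⟩
      rw [this, Finset.card_map, Finset.card_fin]
    rw [activeWeights_ffArch]
    simpa using this
  · obtain ⟨θ, hθ⟩ := exists_weights_ffArch 0 (fun _ => d) (by omega)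
      (fun _ => Finset.univ.filter fun x => x.1 = x.2) (fun _ => 1) (fun _ => 0) (by
        intro _ i j h
        refine Finset.mem_filter.2 ⟨Finset.mem_univ _, ?_⟩
        by_contra h'
        exact h (Matrix.one_apply_ne h'))
    exact ⟨θ, fun x => (hθ x).trans (Matrix.one_mulVec x)⟩

/-- The number of nonzero entries of a matrix. -/
noncomputable def nnz {ι κ : Type*} [Fintype ι] [Fintype κ] (M : Matrix ι κ ℝ) : ℕ := by
  classical exact (Finset.univ.filter fun x : ι × κ => M x.1 x.2 ≠ 0).card

/-- A network with three hidden layers whose hidden part is prescribed: the architecture depends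
only on the hidden blocks, so that the output matrix is free. -/
theorem exists_architecture_three_hidden {d w₁ w₂ w₃ : ℕ} (m : ℕ) (h₁ : 0 < w₁) (h₂ : 0 < w₂)
    (h₃ : 0 < w₃) (M₁ : Matrix (Fin w₁) (Fin d) ℝ) (M₂ : Matrix (Fin w₂) (Fin w₁) ℝ)
    (M₃ : Matrix (Fin w₃) (Fin w₂) ℝ) (b₁ : Fin w₁ → ℝ) (b₂ : Fin w₂ → ℝ) (b₃ : Fin w₃ → ℝ) :
    ∃ a : Architecture d m, a.depth = 4 ∧
      a.activeWeights = nnz M₁ + w₁ + (nnz M₂ + w₂) + (nnz M₃ + w₃) + m * w₃ ∧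
      ∀ B : Matrix (Fin m) (Fin w₃) ℝ, ∃ θ : a.Weights, ∀ x, θ.realize x =
        B *ᵥ reluVec (M₃ *ᵥ reluVec (M₂ *ᵥ reluVec (M₁ *ᵥ x + b₁) + b₂) + b₃) := by
  classical
  let w : ℕ → ℕ := fun l => match l with
    | 0 => d
    | 1 => w₁
    | 2 => w₂
    | 3 => w₃
    | _ + 4 => m
  let mask : (l : ℕ) → Finset (Fin (w (l + 1)) × Fin (w l)) := fun l => match l with
    | 0 => Finset.univ.filter fun x : Fin w₁ × Fin d => M₁ x.1 x.2 ≠ 0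
    | 1 => Finset.univ.filter fun x : Fin w₂ × Fin w₁ => M₂ x.1 x.2 ≠ 0
    | 2 => Finset.univ.filter fun x : Fin w₃ × Fin w₂ => M₃ x.1 x.2 ≠ 0
    | _ + 3 => Finset.univ
  have hw : ∀ l, 0 < l → l < 3 + 1 → 0 < w l := by
    intro l hl hl'
    interval_cases l
    exacts [h₁, h₂, h₃]
  refine ⟨ffArch 3 w hw mask, rfl, ?_, fun B => ?_⟩
  · rw [activeWeights_ffArch]
    simp only [Finset.sum_range_succ, Finset.sum_range_zero]
    have e0 : (mask 0).card = nnz M₁ := by unfold nnz; convert rfl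
    have e1 : (mask 1).card = nnz M₂ := by unfold nnz; convert rfl
    have e2 : (mask 2).card = nnz M₃ := by unfold nnz; convert rfl
    have e3 : (mask 3).card = m * w₃ := by
      change (Finset.univ : Finset (Fin m × Fin w₃)).card = _
      simp
    rw [e0, e1, e2, e3]
    norm_num [w]
  · let W : (l : ℕ) → Matrix (Fin (w (l + 1))) (Fin (w l)) ℝ := fun l => match l with
      | 0 => M₁
      | 1 => M₂
      | 2 => M₃
      | 3 => B
      | _ + 4 => 0
    let β : (l : ℕ) → Fin (w l) → ℝ := fun l => match l with
      | 0 => 0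
      | 1 => b₁
      | 2 => b₂
      | 3 => b₃
      | _ + 4 => 0
    obtain ⟨θ, hθ⟩ := exists_weights_ffArch 3 w hw mask W β (by
      intro l i j h
      rcases l with _ | _ | _ | l
      · exact Finset.mem_filter.2 ⟨Finset.mem_univ _, h⟩
      · exact Finset.mem_filter.2 ⟨Finset.mem_univ _, h⟩
      · exact Finset.mem_filter.2 ⟨Finset.mem_univ _, h⟩
      · exact Finset.mem_univ _)
    exact ⟨θ, hθ⟩

theorem nnz_submatrix {ι κ ι' κ' : Type*} [Fintype ι] [Fintype κ] [Fintype ι'] [Fintype κ']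
    (M : Matrix ι κ ℝ) (e : ι' ≃ ι) (f : κ' ≃ κ) : nnz (M.submatrix e f) = nnz M := by
  classical
  unfold nnz
  refine Finset.card_bij' (fun x _ => (e x.1, f x.2)) (fun x _ => (e.symm x.1, f.symm x.2))
    (fun x hx => ?_) (fun x hx => ?_) ?_ ?_
  · exact Finset.mem_filter.2 ⟨Finset.mem_univ _, (Finset.mem_filter.1 hx).2⟩
  · refine Finset.mem_filter.2 ⟨Finset.mem_univ _, ?_⟩
    simpa using (Finset.mem_filter.1 hx).2
  · simp
  · simp

/-- The nonzero entries of a matrix are counted row by row, with at most `r` in each. -/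
theorem nnz_le {ι κ : Type*} [Fintype ι] [Fintype κ] (M : Matrix ι κ ℝ) (r : ℕ)
    (s : ι → Finset κ) (hs : ∀ i, (s i).card ≤ r) (hM : ∀ i j, M i j ≠ 0 → j ∈ s i) :
    nnz M ≤ Fintype.card ι * r := by
  classical
  unfold nnz
  calc _ ≤ (Finset.univ.sigma s).card := by
        refine Finset.card_le_card_of_injOn (fun x => ⟨x.1, x.2⟩) ?_ ?_
        · intro x hx
          simpa using hM _ _ (Finset.mem_filter.1 hx).2
        · intro x _ y _ h
          simp only [Sigma.mk.injEq, heq_eq_eq] at h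
          exact Prod.ext h.1 h.2
    _ = ∑ i, (s i).card := Finset.card_sigma _ _
    _ ≤ ∑ _i : ι, r := Finset.sum_le_sum fun i _ => hs i
    _ = _ := by simp

/-- The same as `exists_architecture_three_hidden`, for layers indexed by arbitrary finite types. -/
theorem exists_architecture_of_blocks {d : ℕ} {ι₁ ι₂ ι₃ : Type} [Fintype ι₁] [Fintype ι₂]
    [Fintype ι₃] [Nonempty ι₁] [Nonempty ι₂] [Nonempty ι₃] (m : ℕ)
    (M₁ : Matrix ι₁ (Fin d) ℝ) (M₂ : Matrix ι₂ ι₁ ℝ)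
    (M₃ : Matrix ι₃ ι₂ ℝ) (b₁ : ι₁ → ℝ) (b₂ : ι₂ → ℝ) (b₃ : ι₃ → ℝ) :
    ∃ a : Architecture d m, a.depth = 4 ∧
      a.activeWeights = nnz M₁ + Fintype.card ι₁ + (nnz M₂ + Fintype.card ι₂) +
        (nnz M₃ + Fintype.card ι₃) + m * Fintype.card ι₃ ∧
      ∀ B : Matrix (Fin m) ι₃ ℝ, ∃ θ : a.Weights, ∀ x, θ.realize x =
        B *ᵥ reluVec (M₃ *ᵥ reluVec (M₂ *ᵥ reluVec (M₁ *ᵥ x + b₁) + b₂) + b₃) := by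
  let e₁ := (Fintype.equivFin ι₁).symm
  let e₂ := (Fintype.equivFin ι₂).symm
  let e₃ := (Fintype.equivFin ι₃).symm
  obtain ⟨a, had, haw, ha⟩ := exists_architecture_three_hidden m Fintype.card_pos Fintype.card_pos
    Fintype.card_pos (M₁.submatrix e₁ (Equiv.refl _)) (M₂.submatrix e₂ e₁) (M₃.submatrix e₃ e₂)
    (b₁ ∘ e₁) (b₂ ∘ e₂) (b₃ ∘ e₃)
  refine ⟨a, had, ?_, fun B => ?_⟩
  · rw [haw, nnz_submatrix, nnz_submatrix, nnz_submatrix]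
  · obtain ⟨θ, hθ⟩ := ha (B.submatrix (Equiv.refl _) e₃)
    refine ⟨θ, fun x => ?_⟩
    have key : ∀ {ι κ ι' κ' : Type} [Fintype κ] [Fintype κ'] (M : Matrix ι κ ℝ) (e : ι' ≃ ι)
        (f : κ' ≃ κ) (v : κ → ℝ), M.submatrix e f *ᵥ (v ∘ f) = (M *ᵥ v) ∘ e := by
      intro ι κ ι' κ' _ _ M e f v
      rw [Matrix.submatrix_mulVec_equiv]
      simp [Function.comp_assoc]
    have kr : ∀ {ι ι' : Type} (e : ι' ≃ ι) (v w : ι → ℝ),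
        reluVec (v ∘ e + w ∘ e) = reluVec (v + w) ∘ e := fun _ _ _ => rfl
    rw [hθ, show x = x ∘ Equiv.refl (Fin d) from rfl, key, kr, key, kr, key, kr, key]
    rfl

/-! ### A partition of unity computed by a network -/

/-- Telescoping: nonnegative bumps whose sum is at least `1` are turned into a partition of unity
subordinate to them by truncating the partial sums at `1`. In the partial sum with index `k`, only
the bumps that may overlap the `k`-th one have to be taken into account. -/
theorem sum_partition_eq_one {K : ℕ} (c : Fin K → ℝ) (hc : ∀ k, 0 ≤ c k)
    (N : Fin K → Fin K → Prop) [∀ j k, Decidable (N j k)]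
    (hN : ∀ j k, 0 < c j → 0 < c k → N j k) (h1 : ∃ k, 1 ≤ c k) (ψ : Fin K → ℝ)
    (hψ : ∀ k, ψ k = relu (1 - ∑ j, if j < k ∧ N j k then c j else 0) -
      relu (1 - ∑ j, if j ≤ k ∧ N j k then c j else 0)) :
    (∀ k, 0 ≤ ψ k) ∧ (∀ k, ψ k ≠ 0 → 0 < c k) ∧ ∑ k, ψ k = 1 := by
  have hmono : ∀ {a b : ℝ}, a ≤ b → relu a ≤ relu b := fun h => max_le_max h le_rfl
  have hzero : ∀ k, c k = 0 → ψ k = 0 := by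
    intro k hk
    rw [hψ, sub_eq_zero]
    congr 2
    refine Finset.sum_congr rfl fun j _ => ?_
    by_cases hj : j = k
    · subst hj; simp [hk]
    · simp [le_iff_lt_or_eq, hj]
  let r : ℕ → ℝ := fun n => relu (1 - ∑ j : Fin K, if (j : ℕ) < n then c j else 0)
  have hr : ∀ k : Fin K, ψ k = r k - r (k + 1) := by
    intro k
    rcases (hc k).eq_or_lt with hk | hk
    · rw [hzero k hk.symm, eq_comm, sub_eq_zero]
      simp only [r]
      congr 2
      refine Finset.sum_congr rfl fun j _ => ?_
      by_cases hj : j = k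
      · subst hj; simp [← hk]
      · have : (j : ℕ) ≠ k := fun h => hj (Fin.ext h)
        have : (j : ℕ) < k ↔ (j : ℕ) < k + 1 := by omega
        simp only [this]
    · rw [hψ]
      simp only [r]
      congr 3
      · refine Finset.sum_congr rfl fun j _ => ?_
        rcases (hc j).eq_or_lt with hj | hj
        · simp [← hj]
        · simp [hN j k hj hk]
      · refine Finset.sum_congr rfl fun j _ => ?_
        rcases (hc j).eq_or_lt with hj | hj
        · simp [← hj]
        · simp [hN j k hj hk]
  refine ⟨fun k => ?_, fun k hk => ?_, ?_⟩
  · rw [hψ, sub_nonneg]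
    refine hmono (sub_le_sub_left (Finset.sum_le_sum fun j _ => ?_) _)
    by_cases h : j < k ∧ N j k
    · rw [if_pos h, if_pos ⟨h.1.le, h.2⟩]
    · rw [if_neg h]
      split_ifs
      exacts [hc j, le_rfl]
  · exact (hc k).lt_of_ne fun h => hk (hzero k h.symm)
  · calc ∑ k, ψ k = ∑ k : Fin K, (r k - r (k + 1)) := Finset.sum_congr rfl fun k _ => hr k
      _ = ∑ n ∈ Finset.range K, (r n - r (n + 1)) :=
          Fin.sum_univ_eq_sum_range (fun n => r n - r (n + 1)) K
      _ = r 0 - r K := Finset.sum_range_sub' r K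
      _ = 1 := by
        obtain ⟨k, hk⟩ := h1
        have h0 : r 0 = 1 := by simp [r, relu]
        have hK : r K = 0 := by
          have : 1 ≤ ∑ j, c j :=
            hk.trans (Finset.single_le_sum (fun j _ => hc j) (Finset.mem_univ k))
          simp only [r, Fin.is_lt, if_true, relu]
          exact max_eq_right (by linarith)
        rw [h0, hK, sub_zero]

/-- A network for the linear combinations of the partition of unity subordinate to the bumps
`x ↦ relu (d + 1 - ∑ i, |x i / h - z k i|)`. Only its output layer depends on the coefficients `F`.
-/
theorem exists_architecture_bumps {d K : ℕ} (hd : 0 < d) (hK : 0 < K) (h : ℝ)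
    (z : Fin K → Fin d → ℝ) (N : Fin K → Fin K → Prop) [∀ j k, Decidable (N j k)] (r : ℕ)
    (hr : ∀ k, (Finset.univ.filter fun j => N j k).card ≤ r) (m : ℕ) :
    ∃ a : Architecture d m, a.depth = 4 ∧ a.activeWeights ≤ K * (6 * d + 3 + 2 * r + 2 * m) ∧
      ∀ F : Matrix (Fin m) (Fin K) ℝ, ∃ θ : a.Weights, ∀ (x : Fin d → ℝ) (c : Fin K → ℝ),
        (∀ k, c k = relu (d + 1 - ∑ i, |x i / h - z k i|)) →
        θ.realize x = F *ᵥ fun k => relu (1 - ∑ j, if j < k ∧ N j k then c j else 0) -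
          relu (1 - ∑ j, if j ≤ k ∧ N j k then c j else 0) := by
  classical
  have : Nonempty (Fin d) := ⟨⟨0, hd⟩⟩
  have : Nonempty (Fin K) := ⟨⟨0, hK⟩⟩
  -- the first layer holds the positive and negative parts of `x i / h - z k i`, the second one the
  -- bumps, and the third one the truncated partial sums up to `j < k` and up to `j ≤ k`
  let sg : Bool → ℝ := fun b => if b then 1 else -1
  let M₁ : Matrix (Fin K × Fin d × Bool) (Fin d) ℝ :=
    Matrix.of fun x i => if i = x.2.1 then sg x.2.2 / h else 0
  let M₂ : Matrix (Fin K) (Fin K × Fin d × Bool) ℝ :=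
    Matrix.of fun k x => if x.1 = k then -1 else 0
  let M₃ : Matrix (Fin K × Bool) (Fin K) ℝ :=
    Matrix.of fun x j => if (if x.2 then j < x.1 else j ≤ x.1) ∧ N j x.1 then -1 else 0
  obtain ⟨a, had, haw, ha⟩ := exists_architecture_of_blocks m M₁ M₂ M₃
    (fun x => - (sg x.2.2 * z x.1 x.2.1)) (fun _ => d + 1) (fun _ => 1)
  refine ⟨a, had, ?_, fun F => ?_⟩
  · have n₁ : nnz M₁ ≤ Fintype.card (Fin K × Fin d × Bool) * 1 := by
      refine nnz_le M₁ 1 (fun x => {x.2.1}) (fun _ => le_rfl) fun x i hi => ?_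
      by_contra h'
      exact hi (if_neg (by simpa using h'))
    have n₂ : nnz M₂ ≤ Fintype.card (Fin K) * (d * 2) := by
      refine nnz_le M₂ _ (fun k => {k} ×ˢ Finset.univ) (fun k => by simp) fun k x hx => ?_
      by_contra h'
      exact hx (if_neg fun h => h' (Finset.mem_product.2 ⟨by simp [h], Finset.mem_univ _⟩))
    have n₃ : nnz M₃ ≤ Fintype.card (Fin K × Bool) * r := by
      refine nnz_le M₃ r (fun x => Finset.univ.filter fun j => N j x.1) (fun x => hr _)
        fun x j hj => ?_
      by_contra h'
      exact hj (if_neg fun h'' => h' (by simpa using h''.2))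
    rw [haw]
    simp only [Fintype.card_prod, Fintype.card_fin, Fintype.card_bool] at n₁ n₂ n₃ ⊢
    nlinarith
  · obtain ⟨θ, hθ⟩ := ha (Matrix.of fun i x => sg x.2 * F i x.1)
    refine ⟨θ, fun x c hc => ?_⟩
    have e₂ : reluVec (M₂ *ᵥ reluVec (M₁ *ᵥ x + fun x => - (sg x.2.2 * z x.1 x.2.1)) +
        fun _ => (d : ℝ) + 1) = c := by
      ext k
      rw [hc]
      simp only [reluVec, Pi.add_apply, Matrix.mulVec, dotProduct, M₂, M₁, Matrix.of_apply,
        Fintype.sum_prod_type, Fintype.sum_bool, ite_mul, zero_mul, Finset.sum_ite_eq',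
        Finset.mem_univ, if_true]
      congr 1
      rw [Finset.sum_eq_single_of_mem k (Finset.mem_univ _)
        (fun j _ hj => Finset.sum_eq_zero fun i _ => by simp [hj])]
      rw [add_comm, sub_eq_add_neg, ← Finset.sum_neg_distrib]
      congr 1
      refine Finset.sum_congr rfl fun i _ => ?_
      simp only [if_true, sg, relu, Bool.false_eq_true, if_false]
      have e : 1 / h * x i + -(1 * z k i) = x i / h - z k i := by ring
      have e' : -1 / h * x i + -(-1 * z k i) = -(x i / h - z k i) := by ring
      rw [e, e']
      rcases le_total 0 (x i / h - z k i) with h0 | h0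
      · rw [max_eq_left h0, max_eq_right (by linarith), abs_of_nonneg h0]; ring
      · rw [max_eq_right h0, max_eq_left (by linarith), abs_of_nonpos h0]; ring
    rw [hθ, e₂]
    ext i
    simp only [reluVec, Pi.add_apply, Matrix.mulVec, dotProduct, M₃, Matrix.of_apply,
        Fintype.sum_prod_type, Fintype.sum_bool]
    refine Finset.sum_congr rfl fun k _ => ?_
    simp only [if_true, sg, Bool.false_eq_true, if_false, ite_mul, neg_mul, one_mul, zero_mul]
    have e : ∀ P : Fin K → Prop, ∀ [DecidablePred P],
        (∑ j, if P j then -c j else 0) + 1 = 1 - ∑ j, if P j then c j else 0 := by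
      intro P _
      rw [add_comm, sub_eq_add_neg, ← Finset.sum_neg_distrib]
      congr 1
      refine Finset.sum_congr rfl fun j _ => ?_
      split_ifs <;> simp
    rw [e, e]
    ring

/-- The points of `ℤᵈ` in a cube, in units of the mesh size `h`: there are `O(h⁻ᵈ)` of them, each
point of `[-R, R]ᵈ` is close to one of them, and a ball around one of them contains boundedly many.
-/
theorem exists_lattice (d : ℕ) {R : ℝ} (hR : 0 < R) {h : ℝ} (hh : h ∈ Ioc (0 : ℝ) 1) :
    ∃ (K : ℕ) (z : Fin K → Fin d → ℝ), 0 < K ∧ (K : ℝ) ≤ (2 * R + 3) ^ d * h⁻¹ ^ d ∧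
      (∀ x : Fin d → ℝ, (∀ i, |x i| ≤ R) → ∃ k, ∑ i, |x i / h - z k i| ≤ d) ∧
      ∀ D : ℕ, ∀ k, ∀ s : Finset (Fin K), (∀ j ∈ s, ∀ i, |z j i - z k i| ≤ D) →
        s.card ≤ (2 * D + 1) ^ d := by
  classical
  obtain ⟨h0, h1⟩ := hh
  set M : ℕ := ⌈R / h⌉₊ with hM
  have hMle : R / h ≤ M := Nat.le_ceil _
  have hMlt : (M : ℝ) < R / h + 1 := Nat.ceil_lt_add_one (by positivity)
  let e := (Fintype.equivFin (Fin d → Fin (2 * M + 1))).symm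
  refine ⟨_, fun k i => ((e k i : ℕ) : ℝ) - M, Fintype.card_pos, ?_, ?_, ?_⟩
  · have : 2 * (M : ℝ) + 1 ≤ (2 * R + 3) * h⁻¹ := by
      have : 1 ≤ h⁻¹ := (one_le_inv₀ h0).2 h1
      rw [div_eq_mul_inv] at hMlt
      linarith
    rw [← mul_pow, Fintype.card_fun, Fintype.card_fin, Fintype.card_fin]
    push_cast
    exact pow_le_pow_left₀ (by positivity) this d
  · intro x hx
    have hb : ∀ i, -(M : ℝ) ≤ x i / h ∧ x i / h ≤ M := by
      intro i
      rw [← abs_le, abs_div, abs_of_pos h0]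
      exact (div_le_div_of_nonneg_right (hx i) h0.le).trans hMle
    have hn : ∀ i, ⌊x i / h + M⌋₊ < 2 * M + 1 := by
      intro i
      rw [Nat.lt_succ_iff]
      refine Nat.floor_le_of_le ?_
      push_cast
      linarith [(hb i).2]
    refine ⟨e.symm fun i => ⟨_, hn i⟩, ?_⟩
    calc _ ≤ ∑ _i : Fin d, (1 : ℝ) := by
          refine Finset.sum_le_sum fun i _ => ?_
          simp only [Equiv.apply_symm_apply]
          have h1 := Nat.floor_le (a := x i / h + M) (by linarith [(hb i).1])
          have h2 := Nat.lt_floor_add_one (x i / h + M)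
          rw [abs_le]
          constructor <;> linarith
      _ = d := by simp
  · intro D k s hs
    calc s.card ≤
          (Fintype.piFinset fun i => Finset.Icc ((e k i : ℕ) - D) ((e k i : ℕ) + D)).card := by
          refine Finset.card_le_card_of_injOn (fun j i => (e j i : ℕ)) ?_ ?_
          · intro j hj
            rw [Finset.mem_coe, Fintype.mem_piFinset]
            intro i
            have := abs_le.1 (hs j hj i)
            have h1 : ((e k i : ℕ) : ℝ) ≤ (e j i : ℕ) + D := by linarith [this.1]
            have h2 : ((e j i : ℕ) : ℝ) ≤ (e k i : ℕ) + D := by linarith [this.2]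
            rw [Finset.mem_Icc]
            have h1' : (e k i : ℕ) ≤ (e j i : ℕ) + D := by exact_mod_cast h1
            have h2' : (e j i : ℕ) ≤ (e k i : ℕ) + D := by exact_mod_cast h2
            exact ⟨Nat.sub_le_iff_le_add.2 h1', h2'⟩
          · intro j _ j' _ hjj
            refine e.injective (funext fun i => Fin.ext (congrFun hjj i))
      _ = ∏ i, (Finset.Icc ((e k i : ℕ) - D) ((e k i : ℕ) + D)).card := Fintype.card_piFinset _
      _ ≤ ∏ _i : Fin d, (2 * D + 1) := by
          refine Finset.prod_le_prod' fun i _ => ?_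
          rw [Nat.card_Icc]
          omega
      _ = _ := by simp

/-- The rate of approximation of Lipschitz maps by networks of constant depth: a network with
`O(m h⁻ᵈ)` active weights, whose architecture depends only on `h` and on the dimensions,
approximates every Lipschitz map from a bounded set to `ℝᵐ` up to an error `O(h)`. The error is
measured in the Euclidean norm and does not depend on `m`. -/
theorem exists_architecture_lipschitz (d : ℕ) (hd : 0 < d) {R : ℝ} (hR : 0 < R) :
    ∃ C : ℝ, 0 < C ∧ ∀ h ∈ Ioc (0 : ℝ) 1, ∀ m : ℕ, ∃ a : Architecture d m, a.depth ≤ 4 ∧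
      (a.activeWeights : ℝ) ≤ C * m * h⁻¹ ^ d ∧
      ∀ (X : Set (Fin d → ℝ)) (f : (Fin d → ℝ) → EuclideanSpace ℝ (Fin m)) (Λ : ℝ), 0 ≤ Λ →
        (∀ x ∈ X, ∀ i, |x i| ≤ R) →
        (∀ x ∈ X, ∀ y ∈ X, ‖f x - f y‖ ≤ Λ * ∑ i, |x i - y i|) →
        ∃ θ : a.Weights, ∀ x ∈ X,
          ‖WithLp.toLp 2 (θ.realize x) - f x‖ ≤ Λ * (2 * (d + 1) * h) := by
  classical
  set r := (2 * (2 * (d + 1)) + 1) ^ d with hr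
  refine ⟨(2 * R + 3) ^ d * (6 * d + 5 + 2 * r), by positivity, fun h hh m => ?_⟩
  have h0 := hh.1
  -- without outputs, no weight at all may be active
  rcases Nat.eq_zero_or_pos m with rfl | hm
  · refine ⟨ffArch 0 (fun l => match l with | 0 => d | _ + 1 => 0) (by omega) (fun _ => ∅), ?_,
      ?_, ?_⟩
    · change 1 ≤ 4
      norm_num
    · rw [activeWeights_ffArch]
      simp
    · intro X f Λ hΛ _ _
      refine ⟨⟨fun _ _ _ => 0, fun _ _ => 0⟩, fun x _ => ?_⟩
      rw [Subsingleton.elim (WithLp.toLp 2 _ - f x) 0, norm_zero]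
      positivity
  obtain ⟨K, z, hK, hKle, hz, hcard⟩ := exists_lattice d hR hh
  let N : Fin K → Fin K → Prop := fun j k => ∀ i, |z j i - z k i| ≤ (2 * (d + 1) : ℕ)
  obtain ⟨a, had, haw, ha⟩ := exists_architecture_bumps hd hK h z N r
    (fun k => hcard _ k _ fun j hj => (Finset.mem_filter.1 hj).2) m
  refine ⟨a, had.le, ?_, fun X f Λ hΛ hX hf => ?_⟩
  · have hm1 : (1 : ℝ) ≤ m := by exact_mod_cast hm
    calc (a.activeWeights : ℝ) ≤ ((K * (6 * d + 3 + 2 * r + 2 * m) : ℕ) : ℝ) := by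
          exact_mod_cast haw
      _ = K * (6 * d + 3 + 2 * r + 2 * m) := by push_cast; ring
      _ ≤ ((2 * R + 3) ^ d * h⁻¹ ^ d) * (m * (6 * d + 5 + 2 * r)) := by
          refine mul_le_mul hKle ?_ (by positivity) (by positivity)
          have : (0 : ℝ) ≤ (m - 1) * (6 * d + 3 + 2 * r) :=
            mul_nonneg (by linarith) (by positivity)
          linarith
      _ = _ := by ring
  · let c : (Fin d → ℝ) → Fin K → ℝ := fun x k => relu (d + 1 - ∑ i, |x i / h - z k i|)
    have hc : ∀ x k, 0 < c x k → ∑ i, |x i / h - z k i| < d + 1 := by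
      intro x k hx
      by_contra! h'
      have : c x k = 0 := max_eq_right (by linarith)
      exact hx.ne' this
    -- the centres need not lie in `X`: sample `f` at some point of `X` in the support of the bump
    let F : Fin K → EuclideanSpace ℝ (Fin m) := fun k =>
      if hk : ∃ y ∈ X, 0 < c y k then f hk.choose else 0
    have hF : ∀ x ∈ X, ∀ k, 0 < c x k → ‖F k - f x‖ ≤ Λ * (2 * (d + 1) * h) := by
      intro x hx k hk
      have hk' : ∃ y ∈ X, 0 < c y k := ⟨x, hx, hk⟩
      simp only [F, dif_pos hk']
      obtain ⟨hyX, hy⟩ := hk'.choose_spec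
      set y := hk'.choose
      refine (hf y hyX x hx).trans (mul_le_mul_of_nonneg_left ?_ hΛ)
      have h1 := hc x k hk
      have h2 := hc y k hy
      calc ∑ i, |y i - x i| ≤ ∑ i, (|y i / h - z k i| + |x i / h - z k i|) * h := by
            refine Finset.sum_le_sum fun i _ => ?_
            have : y i - x i = ((y i / h - z k i) - (x i / h - z k i)) * h := by
              field_simp
              ring
            rw [this, abs_mul, abs_of_pos h0]
            exact mul_le_mul_of_nonneg_right (abs_sub _ _) h0.le
        _ = (∑ i, |y i / h - z k i| + ∑ i, |x i / h - z k i|) * h := by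
            rw [← Finset.sum_mul, Finset.sum_add_distrib]
        _ ≤ (2 * (d + 1)) * h := mul_le_mul_of_nonneg_right (by linarith) h0.le
    obtain ⟨θ, hθ⟩ := ha (Matrix.of fun i k => F k i)
    refine ⟨θ, fun x hx => ?_⟩
    rw [hθ x (c x) fun k => rfl]
    set ψ : Fin K → ℝ := fun k => relu (1 - ∑ j, if j < k ∧ N j k then c x j else 0) -
          relu (1 - ∑ j, if j ≤ k ∧ N j k then c x j else 0) with hψ
    obtain ⟨p1, p2, p3⟩ := sum_partition_eq_one (c x) (fun k => le_max_right _ _) N (by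
      intro j k hj hk i
      have h1 := hc x j hj
      have h2 := hc x k hk
      have h3 := Finset.single_le_sum (f := fun i => |x i / h - z j i|)
        (fun i _ => abs_nonneg _) (Finset.mem_univ i)
      have h4 := Finset.single_le_sum (f := fun i => |x i / h - z k i|)
        (fun i _ => abs_nonneg _) (Finset.mem_univ i)
      have h5 := abs_sub (x i / h - z k i) (x i / h - z j i)
      rw [show x i / h - z k i - (x i / h - z j i) = z j i - z k i by ring] at h5
      push_cast
      change |x i / h - z j i| ≤ _ at h3
      change |x i / h - z k i| ≤ _ at h4
      linarith) (by
      obtain ⟨k, hk⟩ := hz x (hX x hx)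
      exact ⟨k, le_max_of_le_left (by linarith)⟩) ψ (fun k => rfl)
    clear_value ψ F
    have hsum : (WithLp.toLp 2 ((Matrix.of fun i k => F k i) *ᵥ ψ) : EuclideanSpace ℝ (Fin m)) -
        f x = ∑ k, ψ k • (F k - f x) := by
      simp only [smul_sub, Finset.sum_sub_distrib, ← Finset.sum_smul, p3, one_smul]
      congr 1
      ext i
      simp only [Matrix.mulVec, dotProduct, Matrix.of_apply, WithLp.ofLp_sum, WithLp.ofLp_smul,
        Finset.sum_apply, Pi.smul_apply, smul_eq_mul]
      exact Finset.sum_congr rfl fun k _ => mul_comm _ _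
    rw [hsum]
    calc ‖∑ k, ψ k • (F k - f x)‖ ≤ ∑ k, ψ k * (Λ * (2 * (d + 1) * h)) := by
          refine norm_sum_le_of_le _ fun k _ => ?_
          rw [norm_smul, Real.norm_of_nonneg (p1 k)]
          by_cases hk : ψ k = 0
          · simp [hk]
          · exact mul_le_mul_of_nonneg_left (hF x hx k (p2 k hk)) (p1 k)
      _ = _ := by rw [← Finset.sum_mul, p3, one_mul]

/-! ### Stability of the Gram-Schmidt process -/

/-- Normalizing a vector near a unit vector at most doubles the distance. -/
theorem norm_inv_norm_smul_sub_le {E : Type*} [NormedAddCommGroup E] [NormedSpace ℝ E] {v e : E}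
    (he : ‖e‖ = 1) {κ : ℝ} (hκ : κ < 1) (h : ‖v - e‖ ≤ κ) :
    v ≠ 0 ∧ ‖‖v‖⁻¹ • v - e‖ ≤ 2 * κ := by
  have hv : v ≠ 0 := by
    rintro rfl
    rw [zero_sub, norm_neg, he] at h
    linarith
  have hv' : 0 < ‖v‖ := norm_pos_iff.2 hv
  refine ⟨hv, ?_⟩
  have h1 : ‖‖v‖⁻¹ • v - v‖ ≤ κ := by
    have : ‖v‖⁻¹ • v - v = (‖v‖⁻¹ - 1) • v := by rw [sub_smul, one_smul]
    have e1 : |‖v‖⁻¹ - 1| * ‖v‖ = |1 - ‖v‖| := by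
      rw [← abs_of_pos hv', ← abs_mul, abs_of_pos hv', sub_mul, inv_mul_cancel₀ hv'.ne', one_mul]
    rw [this, norm_smul, Real.norm_eq_abs, e1, ← he, abs_sub_comm]
    exact (abs_norm_sub_norm_le v e).trans h
  calc ‖‖v‖⁻¹ • v - e‖ ≤ ‖‖v‖⁻¹ • v - v‖ + ‖v - e‖ := norm_sub_le_norm_sub_add_norm_sub _ _ _
    _ ≤ 2 * κ := by linarith

theorem one_add_sum_le_pow (j : ℕ) :
    1 + ∑ i ∈ Finset.range j, (4 * (8 : ℝ) ^ i + 1) ≤ 8 ^ j := by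
  induction j with
  | zero => simp
  | succ j ih =>
    rw [Finset.sum_range_succ, pow_succ]
    have : (1 : ℝ) ≤ 8 ^ j := one_le_pow₀ (by norm_num)
    linarith

/-- Gram-Schmidt is Lipschitz near orthonormal families, with a constant that depends only on the
number of vectors. The errors of the first vectors are amplified geometrically. -/
theorem gramSchmidtNormed_stable {E : Type*} [NormedAddCommGroup E] [InnerProductSpace ℝ E] {n : ℕ}
    {e w : Fin n → E} (he : Orthonormal ℝ e) {η : ℝ} (hη : 0 ≤ η) (hη1 : 8 ^ n * η < 1)
    (hw : ∀ j, ‖w j - e j‖ ≤ η) :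
    Orthonormal ℝ (InnerProductSpace.gramSchmidtNormed ℝ w) ∧
      ∀ j, ‖InnerProductSpace.gramSchmidtNormed ℝ w j - e j‖ ≤ 2 * 8 ^ n * η := by
  set g := InnerProductSpace.gramSchmidt ℝ w with hg
  set gN := InnerProductSpace.gramSchmidtNormed ℝ w with hgN
  have hgNg : ∀ j, gN j = ‖g j‖⁻¹ • g j := fun j => rfl
  have hpow : ∀ j : Fin n, (8 : ℝ) ^ (j : ℕ) ≤ 8 ^ n := fun j =>
    pow_le_pow_right₀ (by norm_num) j.2.le
  have hη' : η ≤ 1 := by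
    have : (1 : ℝ) ≤ 8 ^ n := one_le_pow₀ (by norm_num)
    nlinarith
  have key : ∀ j : Fin n, g j ≠ 0 ∧ ‖gN j - e j‖ ≤ 2 * (8 ^ (j : ℕ) * η) := by
    intro j
    induction j using WellFoundedLT.induction with
    | ind j ih =>
    rw [hgNg]
    refine norm_inv_norm_smul_sub_le (he.1 j)
      ((mul_le_mul_of_nonneg_right (hpow j) hη).trans_lt hη1) ?_
    have hdef := InnerProductSpace.gramSchmidt_def'' ℝ w j
    have hterm : ∀ i ∈ Finset.Iio j,
        ‖(inner ℝ (g i) (w j) / (‖g i‖ : ℝ) ^ 2) • g i‖ ≤ (4 * 8 ^ (i : ℕ) + 1) * η := by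
      intro i hi
      obtain ⟨hgi, hi'⟩ := ih i (Finset.mem_Iio.1 hi)
      have hgi' : 0 < ‖g i‖ := norm_pos_iff.2 hgi
      have e1 : (inner ℝ (g i) (w j) / (‖g i‖ : ℝ) ^ 2) • g i = inner ℝ (gN i) (w j) • gN i := by
        rw [hgNg, inner_smul_left, smul_smul]
        congr 1
        simp only [conj_trivial]
        field_simp
      have n1 : ‖gN i‖ = 1 := by
        rw [hgNg, norm_smul, norm_inv, norm_norm, inv_mul_cancel₀ hgi'.ne']
      have e2 : inner ℝ (gN i) (w j) = inner ℝ (gN i - e i) (w j) + inner ℝ (e i) (w j - e j) := by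
        rw [inner_sub_left, inner_sub_right, he.2 (Finset.mem_Iio.1 hi).ne]
        ring
      have hwj : ‖w j‖ ≤ 2 := by
        have := norm_le_norm_sub_add (w j) (e j)
        rw [he.1 j] at this
        linarith [hw j]
      rw [e1, norm_smul, n1, mul_one, e2]
      calc _ ≤ ‖inner ℝ (gN i - e i) (w j)‖ + ‖inner ℝ (e i) (w j - e j)‖ := norm_add_le _ _
        _ ≤ ‖gN i - e i‖ * ‖w j‖ + ‖e i‖ * ‖w j - e j‖ :=
          add_le_add (norm_inner_le_norm _ _) (norm_inner_le_norm _ _)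
        _ ≤ 2 * (8 ^ (i : ℕ) * η) * 2 + 1 * η := by
          rw [he.1 i]
          exact add_le_add (mul_le_mul hi' hwj (norm_nonneg _) (by positivity))
            (mul_le_mul_of_nonneg_left (hw j) zero_le_one)
        _ = _ := by ring
    have hgj : g j - e j = (w j - e j) -
        ∑ i ∈ Finset.Iio j, (inner ℝ (g i) (w j) / (‖g i‖ : ℝ) ^ 2) • g i := by
      have : w j = g j + ∑ i ∈ Finset.Iio j, (inner ℝ (g i) (w j) / (‖g i‖ : ℝ) ^ 2) • g i := by
        simpa using hdef
      nth_rewrite 1 [this]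
      abel
    rw [hgj]
    calc _ ≤ ‖w j - e j‖ + ∑ i ∈ Finset.Iio j, (4 * 8 ^ (i : ℕ) + 1) * η :=
          (norm_sub_le _ _).trans (add_le_add le_rfl (norm_sum_le_of_le _ hterm))
      _ ≤ η + ∑ i ∈ Finset.Iio j, (4 * 8 ^ (i : ℕ) + 1) * η := add_le_add (hw j) le_rfl
      _ = (1 + ∑ i ∈ Finset.range j, (4 * (8 : ℝ) ^ i + 1)) * η := by
          have : ∑ i ∈ Finset.Iio j, (4 * (8 : ℝ) ^ (i : ℕ) + 1) * η =
              ∑ i ∈ Finset.range j, (4 * (8 : ℝ) ^ i + 1) * η := by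
            rw [← Nat.Iio_eq_range, ← Fin.map_valEmbedding_Iio, Finset.sum_map]
            rfl
          rw [this, ← Finset.sum_mul]
          ring
      _ ≤ 8 ^ (j : ℕ) * η := mul_le_mul_of_nonneg_right (one_add_sum_le_pow j) hη
  refine ⟨⟨fun j => ?_, fun i j hij => ?_⟩, fun j => (key j).2.trans ?_⟩
  · rw [hgNg, norm_smul, norm_inv, norm_norm, inv_mul_cancel₀ (norm_ne_zero_iff.2 (key j).1)]
  · change inner ℝ (gN i) (gN j) = 0
    rw [hgNg, hgNg, inner_smul_left, inner_smul_right,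
      InnerProductSpace.gramSchmidt_orthogonal ℝ w hij]
    simp
  · rw [← mul_assoc]
    have := hpow j
    gcongr

/-! ### Principal components -/

/-- Projecting onto the first `n` eigenvectors of the correlation matrix leaves exactly the tail of
the eigenvalues. The entries of the eigenvectors, which are unit vectors, lie in `[-1, 1]`. -/
theorem exists_principal_components {NA N n : ℕ} (hn : n ≤ NA) (X : Matrix (Fin NA) (Fin N) ℝ)
    (κ : ℝ) (hC : (κ • (X * Xᵀ)).IsHermitian) :
    ∃ W : Matrix (Fin NA) (Fin n) ℝ, (∀ i j, W i j ∈ Icc (-1 : ℝ) 1) ∧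
      κ * ∑ i, ‖(WithLp.toLp 2 (Xᵀ i - (W * Wᵀ) *ᵥ Xᵀ i) : EuclideanSpace ℝ (Fin NA))‖ ^ 2 =
        ∑ k : Fin (Fintype.card (Fin NA)), if n ≤ (k : ℕ) then hC.eigenvalues₀ k else 0 := by
  let b := hC.eigenvectorBasis
  let σ : Fin (Fintype.card (Fin NA)) ≃ Fin NA := Fintype.equivOfCardEq (Fintype.card_fin _)
  have hσ : ∀ k, hC.eigenvalues (σ k) = hC.eigenvalues₀ k := by
    intro k
    simp only [Matrix.IsHermitian.eigenvalues]
    exact congrArg _ (σ.symm_apply_apply k)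
  let ι : Fin n → Fin (Fintype.card (Fin NA)) := fun j => ⟨j, by simpa using j.2.trans_le hn⟩
  have hι : ∀ j k, ι j = k ↔ (j : ℕ) = k := fun j k => Fin.ext_iff
  let x : Fin N → EuclideanSpace ℝ (Fin NA) := fun i => WithLp.toLp 2 (Xᵀ i)
  let W : Matrix (Fin NA) (Fin n) ℝ := Matrix.of fun r j => b (σ (ι j)) r
  have hdot : ∀ v w : EuclideanSpace ℝ (Fin NA), inner ℝ v w = ∑ r, v r * w r := by
    intro v w
    rw [PiLp.inner_apply]
    exact Finset.sum_congr rfl fun r _ => by simp [mul_comm]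
  refine ⟨W, fun i j => ?_, ?_⟩
  · have h1 := PiLp.norm_apply_le (b (σ (ι j))) i
    rw [b.norm_eq_one, Real.norm_eq_abs] at h1
    exact abs_le.1 h1
  · have c1 : ∀ i, (WithLp.toLp 2 (Xᵀ i - (W * Wᵀ) *ᵥ Xᵀ i) : EuclideanSpace ℝ (Fin NA)) =
        x i - ∑ j, inner ℝ (b (σ (ι j))) (x i) • b (σ (ι j)) := by
      intro i
      rw [WithLp.toLp_sub]
      congr 1
      ext r
      rw [← Matrix.mulVec_mulVec]
      simp only [Matrix.mulVec, dotProduct, W, Matrix.of_apply, Matrix.transpose_apply,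
        WithLp.ofLp_sum, WithLp.ofLp_smul, Finset.sum_apply, Pi.smul_apply, smul_eq_mul, hdot, x]
      exact Finset.sum_congr rfl fun j _ => mul_comm _ _
    have c2 : ∀ i k, inner ℝ (b (σ k)) (x i - ∑ j, inner ℝ (b (σ (ι j))) (x i) • b (σ (ι j))) =
        if n ≤ (k : ℕ) then inner ℝ (b (σ k)) (x i) else 0 := by
      intro i k
      rw [inner_sub_right, inner_sum]
      simp only [inner_smul_right, b.inner_eq_ite, σ.injective.eq_iff]
      split_ifs with h
      · rw [Finset.sum_eq_zero, sub_zero]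
        intro j _
        rw [if_neg, mul_zero]
        intro hk
        have := (hι j k).1 hk.symm
        have := j.2
        omega
      · rw [sub_eq_zero, eq_comm, Finset.sum_eq_single_of_mem ⟨k, by omega⟩ (Finset.mem_univ _)]
        · have : ι ⟨k, by omega⟩ = k := (hι _ _).2 rfl
          rw [this]
          simp
        · intro j _ hj
          rw [if_neg, mul_zero]
          intro hk
          exact hj (Fin.ext ((hι j k).1 hk.symm))
    have c3 : ∀ k, κ * ∑ i, inner ℝ (b k) (x i) ^ 2 = hC.eigenvalues k := by
      intro k
      have e : ∀ i, inner ℝ (b k) (x i) = (Xᵀ *ᵥ (b k).ofLp) i := by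
        intro i
        rw [hdot]
        simp only [x, Matrix.mulVec, dotProduct]
        exact Finset.sum_congr rfl fun j _ => mul_comm _ _
      have h2 := hC.eigenvalues_eq k
      rw [RCLike.re_to_real, Matrix.smul_mulVec, dotProduct_smul, ← Matrix.mulVec_mulVec,
        Matrix.dotProduct_mulVec, star_trivial, ← Matrix.mulVec_transpose] at h2
      rw [h2, smul_eq_mul]
      congr 1
      refine Finset.sum_congr rfl fun i _ => ?_
      rw [e, sq]
    have c4 : ∀ i, ‖(WithLp.toLp 2 (Xᵀ i - (W * Wᵀ) *ᵥ Xᵀ i) : EuclideanSpace ℝ (Fin NA))‖ ^ 2 =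
        ∑ k, if n ≤ ((k : Fin (Fintype.card (Fin NA))) : ℕ) then inner ℝ (b (σ k)) (x i) ^ 2
          else 0 := by
      intro i
      rw [c1, ← b.sum_sq_norm_inner_right, ← Equiv.sum_comp σ]
      refine Finset.sum_congr rfl fun k _ => ?_
      rw [c2, Real.norm_eq_abs, sq_abs]
      split_ifs <;> simp
    simp only [c4]
    rw [Finset.sum_comm, Finset.mul_sum]
    refine Finset.sum_congr rfl fun k _ => ?_
    split_ifs
    · rw [c3, hσ]
    · simp

/-! ### A uniform law of large numbers -/

theorem exists_measurable_partition {E : Type*} [PseudoMetricSpace E] [MeasurableSpace E]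
    [BorelSpace E] [T2Space E] {K : Set E} (hK : IsCompact K) {r : ℝ} (hr : 0 < r) :
    ∃ (J : ℕ) (P : Fin J → Set E), (∀ j, MeasurableSet (P j)) ∧
      (∀ i j, i ≠ j → Disjoint (P i) (P j)) ∧ ⋃ j, P j = K ∧
      ∀ j, ∀ x ∈ P j, ∀ y ∈ P j, dist x y ≤ r := by
  obtain ⟨t, -, ht, hKt⟩ := hK.finite_cover_balls (half_pos hr)
  obtain ⟨J, f, -, hf⟩ := ht.fin_param
  let Q : ℕ → Set E := fun k => if h : k < J then K ∩ Metric.ball (f ⟨k, h⟩) (r / 2) else ∅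
  have hQ : ∀ k (h : k < J), Q k = K ∩ Metric.ball (f ⟨k, h⟩) (r / 2) := fun k h => dif_pos h
  have hQm : ∀ k, MeasurableSet (Q k) := by
    intro k
    by_cases h : k < J
    · rw [hQ k h]
      exact hK.measurableSet.inter measurableSet_ball
    · simp [Q, h]
  refine ⟨J, fun j => disjointed Q j, fun j => MeasurableSet.disjointed hQm j, ?_, ?_, ?_⟩
  · intro i j hij
    exact disjoint_disjointed Q (fun h => hij (Fin.ext h))
  · have hsub : ∀ k, disjointed Q k ⊆ Q k := fun k => disjointed_le Q k
    apply Subset.antisymm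
    · refine iUnion_subset fun j => (hsub j).trans ?_
      rw [hQ j j.2]
      exact inter_subset_left
    · intro x hx
      obtain ⟨y, hy, hxy⟩ := mem_iUnion₂.1 (hKt hx)
      rw [← hf] at hy
      obtain ⟨j, rfl⟩ := hy
      have hxQ : x ∈ ⋃ k, Q k := mem_iUnion.2 ⟨j, by rw [hQ j j.2]; exact ⟨hx, hxy⟩⟩
      rw [← iUnion_disjointed] at hxQ
      obtain ⟨k, hk⟩ := mem_iUnion.1 hxQ
      have hkJ : k < J := by
        by_contra h
        have := hsub k hk
        simp [Q, h] at this
      exact mem_iUnion.2 ⟨⟨k, hkJ⟩, hk⟩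
  · intro j x hx y hy
    have h1 := disjointed_le Q j hx
    have h2 := disjointed_le Q j hy
    rw [hQ j j.2] at h1 h2
    have := dist_triangle_right x y (f ⟨j, j.2⟩)
    have h3 := Metric.mem_ball.1 h1.2
    have h4 := Metric.mem_ball.1 h2.2
    linarith

/-- Chebyshev's inequality for the frequency of an event in an independent sample. -/
theorem pi_frequency_le {E : Type*} [MeasurableSpace E] (ρ : Measure E) [IsProbabilityMeasure ρ]
    {P : Set E} (hP : MeasurableSet P) {N : ℕ} (hN : 0 < N) {τ : ℝ} (hτ : 0 < τ) :
    Measure.pi (fun _ : Fin N => ρ)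
      {ν | τ ≤ |(∑ i, P.indicator 1 (ν i)) / N - ρ.real P|} ≤ ENNReal.ofReal (1 / (N * τ ^ 2)) := by
  let X : Fin N → E → ℝ := fun _ => P.indicator 1
  have hN' : (0 : ℝ) < N := by exact_mod_cast hN
  have hX1 : MemLp (P.indicator (1 : E → ℝ)) 2 ρ :=
    memLp_indicator_const 2 hP 1 (Or.inr (measure_ne_top _ _))
  have hX : ∀ i, MemLp (fun ν : Fin N → E => P.indicator (1 : E → ℝ) (ν i)) 2
      (Measure.pi fun _ => ρ) := fun i =>
    hX1.comp_measurePreserving (measurePreserving_eval _ i)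
  have hsum : MemLp (∑ i, fun ν : Fin N → E => X i (ν i)) 2 (Measure.pi fun _ => ρ) :=
    memLp_finsetSum' _ fun i _ => hX i
  have hvar : ProbabilityTheory.variance (∑ i, fun ν : Fin N → E => X i (ν i))
      (Measure.pi fun _ => ρ) ≤ N := by
    rw [ProbabilityTheory.variance_sum_pi (fun i => hX1)]
    calc _ ≤ ∑ _i : Fin N, (1 : ℝ) := by
          refine Finset.sum_le_sum fun i _ => ?_
          refine (ProbabilityTheory.variance_le_sq_of_bounded (a := 0) (b := 1) ?_
            hX1.1.aemeasurable).trans (by norm_num)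
          refine Filter.Eventually.of_forall fun x => ?_
          by_cases hx : x ∈ P <;> simp [hx]
      _ = N := by simp
  have hmean : ∫ ν, (∑ i, fun ν : Fin N → E => X i (ν i)) ν ∂(Measure.pi fun _ => ρ) =
      N * ρ.real P := by
    simp only [Finset.sum_apply]
    rw [integral_finsetSum _ fun i _ => (hX i).integrable (by norm_num)]
    have : ∀ i : Fin N, ∫ ν : Fin N → E, X i (ν i) ∂(Measure.pi fun _ => ρ) = ρ.real P := by
      intro i
      rw [integral_comp_eval (μ := fun _ : Fin N => ρ) (i := i) (f := X i) hX1.1]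
      exact integral_indicator_one hP
    refine (Finset.sum_congr rfl fun i _ => this i).trans ?_
    simp
  have hc := ProbabilityTheory.meas_ge_le_variance_div_sq hsum (mul_pos hN' hτ)
  rw [hmean] at hc
  refine (measure_mono fun ν hν => ?_).trans (hc.trans (ENNReal.ofReal_le_ofReal ?_))
  · simp only [mem_ofPred_eq, Finset.sum_apply] at hν ⊢
    have : (∑ i, X i (ν i)) - N * ρ.real P = N * ((∑ i, P.indicator 1 (ν i)) / N - ρ.real P) := by
      simp only [X]
      field_simp
    rw [this, abs_mul, abs_of_pos hN']
    exact mul_le_mul_of_nonneg_left hν hN'.le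
  · calc _ ≤ (N : ℝ) / (N * τ) ^ 2 := div_le_div_of_nonneg_right hvar (by positivity)
      _ = _ := by field_simp

/-- The uniform law of large numbers for the bounded Lipschitz functions on a compact set. No
measurability is needed, since such functions are almost constant on the pieces of a fine
partition, of which only the frequencies have to be controlled. -/
theorem exists_uniform_sample_bound {E : Type*} [MetricSpace E] [MeasurableSpace E] [BorelSpace E]
    (ρ : Measure E) [IsProbabilityMeasure ρ] {K : Set E} (hK : IsCompact K) (hρ : ρ Kᶜ = 0)
    {B Λ τ δ : ℝ} (hB : 0 ≤ B) (hΛ : 0 ≤ Λ) (hτ : 0 < τ) (hδ : 0 < δ) :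
    ∃ N₀ : ℕ, 0 < N₀ ∧ ∀ N : ℕ, N₀ ≤ N → ∃ S : Set (Fin N → E), MeasurableSet S ∧
      Measure.pi (fun _ : Fin N => ρ) Sᶜ < ENNReal.ofReal δ ∧
      ∀ ν ∈ S, (∀ i, ν i ∈ K) ∧ ∀ F : E → ℝ, (∀ x ∈ K, F x ∈ Icc 0 B) →
        (∀ x ∈ K, ∀ y ∈ K, |F x - F y| ≤ Λ * dist x y) →
        ∫⁻ x in K, ENNReal.ofReal (F x) ∂ρ ≤ ENNReal.ofReal ((∑ i, F (ν i)) / N + τ) := by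
  classical
  set r := τ / (4 * (Λ + 1)) with hr_def
  have hr : 0 < r := by positivity
  have hΛr : Λ * r ≤ τ / 4 := by
    rw [hr_def]
    have : Λ * (τ / (4 * (Λ + 1))) = τ / 4 * (Λ / (Λ + 1)) := by field_simp
    rw [this]
    exact mul_le_of_le_one_right (by positivity) ((div_le_one (by positivity)).2 (by linarith))
  obtain ⟨J, P, hPm, hPd, hPK, hPr⟩ := exists_measurable_partition hK hr
  set τ' := τ / (4 * (J * B + 1)) with hτ'_def
  have hτ' : 0 < τ' := by positivity
  have hJτ' : J * B * τ' ≤ τ / 4 := by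
    rw [hτ'_def]
    have : J * B * (τ / (4 * (J * B + 1))) = τ / 4 * (J * B / (J * B + 1)) := by field_simp
    rw [this]
    exact mul_le_of_le_one_right (by positivity) ((div_le_one (by positivity)).2 (by linarith))
  obtain ⟨N₀, hN₀⟩ := exists_nat_gt (J / (τ' ^ 2 * δ))
  refine ⟨N₀ + 1, Nat.succ_pos _, fun N hN => ?_⟩
  have hNpos : 0 < N := by omega
  have hN' : (0 : ℝ) < N := by exact_mod_cast hNpos
  let bad : Fin J → Set (Fin N → E) := fun j =>
    {ν | τ' ≤ |(∑ i, (P j).indicator 1 (ν i)) / N - ρ.real (P j)|}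
  have hmeas : ∀ j, MeasurableSet (bad j) := by
    intro j
    refine measurableSet_le measurable_const ?_
    have : Measurable fun ν : Fin N → E => ∑ i, (P j).indicator (1 : E → ℝ) (ν i) :=
      Finset.measurable_sum _ fun i _ =>
        (measurable_one.indicator (hPm j)).comp (measurable_pi_apply i)
    exact continuous_abs.measurable.comp ((this.div_const _).sub_const _)
  let out : Fin N → Set (Fin N → E) := fun i => (fun ν => ν i) ⁻¹' Kᶜ
  have hKm := hK.measurableSet
  have hout : ∀ i, MeasurableSet (out i) := fun i => measurable_pi_apply i hKm.compl
  refine ⟨((⋃ j, bad j) ∪ ⋃ i, out i)ᶜ,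
    ((MeasurableSet.iUnion hmeas).union (MeasurableSet.iUnion hout)).compl, ?_, ?_⟩
  · rw [compl_compl]
    have hout0 : Measure.pi (fun _ : Fin N => ρ) (⋃ i, out i) = 0 := by
      refine measure_iUnion_null fun i => ?_
      rw [(measurePreserving_eval (fun _ : Fin N => ρ) i).measure_preimage
        hKm.compl.nullMeasurableSet, hρ]
    calc _ ≤ Measure.pi (fun _ : Fin N => ρ) (⋃ j, bad j) + 0 := by
          rw [← hout0]
          exact measure_union_le _ _
      _ ≤ ∑ j, Measure.pi (fun _ : Fin N => ρ) (bad j) := by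
          rw [add_zero]
          exact measure_iUnion_fintype_le _ _
      _ ≤ ∑ _j : Fin J, ENNReal.ofReal (1 / (N * τ' ^ 2)) :=
          Finset.sum_le_sum fun j _ => pi_frequency_le ρ (hPm j) hNpos hτ'
      _ = ENNReal.ofReal (J * (1 / (N * τ' ^ 2))) := by
          rw [ENNReal.ofReal_mul (by positivity)]
          simp
      _ < ENNReal.ofReal δ := by
          refine (ENNReal.ofReal_lt_ofReal_iff hδ).2 ?_
          have h1 : J / (τ' ^ 2 * δ) < N := hN₀.trans_le (by exact_mod_cast (by omega : N₀ ≤ N))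
          rw [div_lt_iff₀ (by positivity)] at h1
          rw [mul_one_div, div_lt_iff₀ (by positivity)]
          linarith
  · intro ν hν
    simp only [mem_compl_iff, mem_union, mem_iUnion, not_or, not_exists] at hν
    obtain ⟨hν1, hν2⟩ := hν
    have hνK : ∀ i, ν i ∈ K := fun i => by simpa [out] using hν2 i
    refine ⟨hνK, fun F hFB hFL => ?_⟩
    have hPsub : ∀ j, P j ⊆ K := fun j => hPK ▸ subset_iUnion P j
    -- a representative value on each piece
    have hval : ∀ j, ∃ c, c ∈ Icc 0 B ∧ ∀ x ∈ P j, |F x - c| ≤ Λ * r := by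
      intro j
      rcases (P j).eq_empty_or_nonempty with h | ⟨y, hy⟩
      · exact ⟨0, ⟨le_rfl, hB⟩, by simp [h]⟩
      · refine ⟨F y, hFB y (hPsub j hy), fun x hx => ?_⟩
        exact (hFL x (hPsub j hx) y (hPsub j hy)).trans
          (mul_le_mul_of_nonneg_left (hPr j x hx y hy) hΛ)
    choose c hcB hc using hval
    let q : Fin J → ℝ := fun j => (∑ i, (P j).indicator 1 (ν i)) / N
    have hfreq : ∀ j, ρ.real (P j) ≤ q j + τ' := by
      intro j
      have := hν1 j
      simp only [bad, mem_ofPred_eq, not_le] at this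
      linarith [(abs_lt.1 this).1]
    have hpsum : ∑ j, ρ.real (P j) ≤ 1 := by
      rw [← measureReal_iUnion_fintype (fun i j h => hPd i j h) hPm]
      exact measureReal_le_one
    have hind : ∀ x ∈ K, ∀ f : Fin J → ℝ, ∀ j₀, x ∈ P j₀ →
        ∑ j, (P j).indicator 1 x * f j = f j₀ := by
      intro x _ f j₀ hx
      rw [Finset.sum_eq_single_of_mem j₀ (Finset.mem_univ _)]
      · simp [hx]
      · intro j _ hj
        have : x ∉ P j := fun h => disjoint_left.1 (hPd j j₀ hj) h hx
        simp [this]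
    have hqc : ∑ j, q j * c j ≤ (∑ i, F (ν i)) / N + Λ * r := by
      have h1 : ∑ j, q j * c j = (∑ i, ∑ j, (P j).indicator 1 (ν i) * c j) / N := by
        rw [Finset.sum_comm, Finset.sum_div]
        refine Finset.sum_congr rfl fun j _ => ?_
        simp only [q]
        rw [← Finset.sum_mul]
        ring
      have h2 : ∀ i, ∑ j, (P j).indicator 1 (ν i) * c j ≤ F (ν i) + Λ * r := by
        intro i
        have hi := hνK i
        rw [← hPK] at hi
        obtain ⟨j₀, hj₀⟩ := mem_iUnion.1 hi
        rw [hind (ν i) (hνK i) c j₀ hj₀]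
        linarith [(abs_le.1 (hc j₀ _ hj₀)).1]
      rw [h1, div_add' _ _ _ hN'.ne']
      refine div_le_div_of_nonneg_right ?_ hN'.le
      calc _ ≤ ∑ i, (F (ν i) + Λ * r) := Finset.sum_le_sum fun i _ => h2 i
        _ = _ := by
          rw [Finset.sum_add_distrib]
          simp [mul_comm]
    calc ∫⁻ x in K, ENNReal.ofReal (F x) ∂ρ ≤ ∑ j, ∫⁻ x in P j, ENNReal.ofReal (F x) ∂ρ := by
          rw [← hPK, ← tsum_fintype (L := .unconditional _)]
          exact lintegral_iUnion_le _ _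
      _ ≤ ∑ j, ENNReal.ofReal ((c j + Λ * r) * ρ.real (P j)) := by
          refine Finset.sum_le_sum fun j _ => ?_
          calc _ ≤ ∫⁻ x in P j, ENNReal.ofReal (c j + Λ * r) ∂ρ := by
                refine setLIntegral_mono' (hPm j) fun x hx => ENNReal.ofReal_le_ofReal ?_
                linarith [(abs_le.1 (hc j x hx)).2]
            _ = _ := by
                have := (hcB j).1
                rw [setLIntegral_const, ENNReal.ofReal_mul (by positivity), ofReal_measureReal]
      _ = ENNReal.ofReal (∑ j, (c j + Λ * r) * ρ.real (P j)) := by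
          refine (ENNReal.ofReal_sum_of_nonneg fun j _ => ?_).symm
          have := (hcB j).1
          positivity
      _ ≤ _ := by
          refine ENNReal.ofReal_le_ofReal ?_
          calc ∑ j, (c j + Λ * r) * ρ.real (P j)
              = ∑ j, c j * ρ.real (P j) + Λ * r * ∑ j, ρ.real (P j) := by
                rw [Finset.mul_sum, ← Finset.sum_add_distrib]
                exact Finset.sum_congr rfl fun j _ => by ring
            _ ≤ ∑ j, (q j * c j + B * τ') + Λ * r * 1 := by
                refine add_le_add (Finset.sum_le_sum fun j _ => ?_)
                  (mul_le_mul_of_nonneg_left hpsum (by positivity))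
                have h1 := mul_le_mul_of_nonneg_left (hfreq j) (hcB j).1
                have h2 := mul_le_mul_of_nonneg_right (hcB j).2 hτ'.le
                linarith
            _ = ∑ j, q j * c j + J * B * τ' + Λ * r := by
                rw [Finset.sum_add_distrib]
                simp
                ring
            _ ≤ _ := by linarith

/-! ### Coordinates with respect to a `G`-orthonormal basis -/

theorem gNorm_mulVec {Nh NA : ℕ} {G : Matrix (Fin Nh) (Fin Nh) ℝ} {A : Matrix (Fin Nh) (Fin NA) ℝ}
    (hA : GOrthonormal G A) (y : Fin NA → ℝ) :
    gNorm G (A *ᵥ y) = ‖(WithLp.toLp 2 y : EuclideanSpace ℝ (Fin NA))‖ := by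
  have : (A *ᵥ y) ⬝ᵥ (G *ᵥ (A *ᵥ y)) = y ⬝ᵥ y := by
    rw [Matrix.mulVec_mulVec, Matrix.dotProduct_mulVec, Matrix.vecMul_mulVec, ← Matrix.mul_assoc,
      show Aᵀ * G * A = 1 from hA, ← Matrix.dotProduct_mulVec, Matrix.one_mulVec]
  rw [gNorm, this, EuclideanSpace.norm_eq]
  congr 1
  exact Finset.sum_congr rfl fun i _ => by simp [sq]

theorem gOrthonormal_mul_iff {Nh NA n : ℕ} {G : Matrix (Fin Nh) (Fin Nh) ℝ}
    {A : Matrix (Fin Nh) (Fin NA) ℝ} (hA : GOrthonormal G A) (W : Matrix (Fin NA) (Fin n) ℝ) :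
    GOrthonormal G (A * W) ↔ Wᵀ * W = 1 := by
  have : (A * W)ᵀ * G * (A * W) = Wᵀ * (Aᵀ * G * A) * W := by
    simp only [Matrix.transpose_mul, Matrix.mul_assoc]
  rw [GOrthonormal, this, show Aᵀ * G * A = 1 from hA, Matrix.mul_one]

/-- For a square `A`, the vector `Aᵀ G v` holds the coordinates of `v` in the columns of `A`. -/
theorem mulVec_coordinates {Nh : ℕ} {G A : Matrix (Fin Nh) (Fin Nh) ℝ}
    (hA : GOrthonormal G A) (v : Fin Nh → ℝ) : A *ᵥ ((Aᵀ * G) *ᵥ v) = v := by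
  rw [Matrix.mulVec_mulVec, mul_eq_one_comm.1 (show Aᵀ * G * A = 1 from hA),
    Matrix.one_mulVec]

theorem gNorm_eq_norm_coordinates {Nh : ℕ} {G A : Matrix (Fin Nh) (Fin Nh) ℝ}
    (hA : GOrthonormal G A) (v : Fin Nh → ℝ) :
    gNorm G v = ‖(WithLp.toLp 2 ((Aᵀ * G) *ᵥ v) : EuclideanSpace ℝ (Fin Nh))‖ := by
  rw [← gNorm_mulVec hA, mulVec_coordinates hA]

/-- The columns of a matrix, as vectors of a Euclidean space. -/
noncomputable def euclideanCol {NA n : ℕ} (W : Matrix (Fin NA) (Fin n) ℝ) (j : Fin n) :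
    EuclideanSpace ℝ (Fin NA) :=
  WithLp.toLp 2 fun r => W r j

theorem inner_eq_sum {k : ℕ} (v w : EuclideanSpace ℝ (Fin k)) : inner ℝ v w = ∑ r, v r * w r := by
  rw [PiLp.inner_apply]
  exact Finset.sum_congr rfl fun r _ => by simp [mul_comm]

theorem orthonormal_euclideanCol_iff {NA n : ℕ} (W : Matrix (Fin NA) (Fin n) ℝ) :
    Orthonormal ℝ (euclideanCol W) ↔ Wᵀ * W = 1 := by
  rw [orthonormal_iff_ite, ← Matrix.ext_iff]
  simp only [inner_eq_sum, Matrix.mul_apply, Matrix.one_apply, euclideanCol, Matrix.transpose_apply]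

theorem toLp_mulVec_eq_sum {NA n : ℕ} (W : Matrix (Fin NA) (Fin n) ℝ) (y : Fin n → ℝ) :
    (WithLp.toLp 2 (W *ᵥ y) : EuclideanSpace ℝ (Fin NA)) = ∑ j, y j • euclideanCol W j := by
  ext r
  simp only [Matrix.mulVec, dotProduct, euclideanCol, WithLp.ofLp_sum, WithLp.ofLp_smul,
    Finset.sum_apply, Pi.smul_apply, smul_eq_mul]
  exact Finset.sum_congr rfl fun j _ => mul_comm _ _

theorem toLp_sub_proj_eq {NA n : ℕ} (W : Matrix (Fin NA) (Fin n) ℝ) (y : Fin NA → ℝ) :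
    (WithLp.toLp 2 (y - (W * Wᵀ) *ᵥ y) : EuclideanSpace ℝ (Fin NA)) =
      WithLp.toLp 2 y - ∑ j, inner ℝ (euclideanCol W j) (WithLp.toLp 2 y) • euclideanCol W j := by
  rw [WithLp.toLp_sub, ← Matrix.mulVec_mulVec, toLp_mulVec_eq_sum]
  congr 1
  refine Finset.sum_congr rfl fun j _ => ?_
  rw [inner_eq_sum]
  rfl

theorem euclideanCol_orth {NA n : ℕ} (W : Matrix (Fin NA) (Fin n) ℝ) (j : Fin n) :
    euclideanCol (orth W) j = InnerProductSpace.gramSchmidtNormed ℝ (euclideanCol W) j := rfl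

section Parametric

variable {p q Nh N n : ℕ} {Θ : Set (EuclideanSpace ℝ (Fin p))} {Θ' : Set (EuclideanSpace ℝ (Fin q))}
  {T : ℝ} {G A : Matrix (Fin Nh) (Fin Nh) ℝ}
  {u : EuclideanSpace ℝ (Fin p) → EuclideanSpace ℝ (Fin q) → ℝ → Fin Nh → ℝ}
  {ν : Fin N → EuclideanSpace ℝ (Fin q)}

theorem objective_mul_eq (hA : GOrthonormal G A) (μ : EuclideanSpace ℝ (Fin p)) (t : ℝ)
    (W : Matrix (Fin Nh) (Fin n) ℝ) :
    objective Θ' G u ν μ t (A * W) = volume.real Θ' / N *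
      ∑ i, ‖(WithLp.toLp 2 ((snapshots G u A ν μ t)ᵀ i - (W * Wᵀ) *ᵥ (snapshots G u A ν μ t)ᵀ i) :
        EuclideanSpace ℝ (Fin Nh))‖ ^ 2 := by
  unfold objective
  congr 1
  refine Finset.sum_congr rfl fun i _ => ?_
  rw [← gNorm_mulVec hA, Matrix.mulVec_sub, show (snapshots G u A ν μ t)ᵀ i =
    (Aᵀ * G) *ᵥ u μ (ν i) t from rfl, mulVec_coordinates hA]
  congr 3
  simp only [Matrix.mulVec_mulVec, Matrix.transpose_mul, Matrix.mul_assoc]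

/-- An optimal DOD is at least as good as the projection onto the principal components. -/
theorem IsOptimalDOD.objective_le (hA : GOrthonormal G A) (hn : n ≤ Nh)
    {s : EuclideanSpace ℝ (Fin p) → ℝ → Matrix (Fin Nh) (Fin n) ℝ}
    (hs : IsOptimalDOD Θ Θ' T G u A ν s) {μ : EuclideanSpace ℝ (Fin p)} (hμ : μ ∈ Θ) {t : ℝ}
    (ht : t ∈ Icc 0 T) :
    objective Θ' G u ν μ t (A * s μ t) ≤ eigenvalueTail Θ' G u A ν μ t n := by
  obtain ⟨W, hW, hW'⟩ := exists_principal_components hn (snapshots G u A ν μ t)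
    (volume.real Θ' / N) (correlation_isHermitian Θ' G u A ν μ t)
  refine ((hs μ hμ t ht).2.2 W hW).trans_eq ?_
  rw [objective_mul_eq hA, hW']
  rfl

/-- The infimum that defines the reduced dimension is attained, since the tail of the eigenvalues
vanishes for `n = Nh`. -/
theorem reducedDim_spec (Θ : Set (EuclideanSpace ℝ (Fin p))) (Θ' : Set (EuclideanSpace ℝ (Fin q)))
    {T : ℝ} (hT : 0 ≤ T) (G A : Matrix (Fin Nh) (Fin Nh) ℝ)
    (u : EuclideanSpace ℝ (Fin p) → EuclideanSpace ℝ (Fin q) → ℝ → Fin Nh → ℝ)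
    (ν : Fin N → EuclideanSpace ℝ (Fin q)) (ε : ℝ) :
    reducedDim Θ Θ' T G u A ν ε ≤ Nh ∧ ∀ μ ∈ Θ, ∀ t ∈ Icc 0 T,
      eigenvalueTail Θ' G u A ν μ t (reducedDim Θ Θ' T G u A ν ε)
        ≤ solutionEssInf Θ Θ' T G u ^ 2 / (16 * (volume.real Θ * T)) * ε ^ 2 := by
  have hmem : Nh ∈ {n : ℕ | ∀ μ ∈ Θ, ∀ t ∈ Icc 0 T, eigenvalueTail Θ' G u A ν μ t n
      ≤ solutionEssInf Θ Θ' T G u ^ 2 / (16 * (volume.real Θ * T)) * ε ^ 2} := by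
    intro μ _ t _
    have : eigenvalueTail Θ' G u A ν μ t Nh = 0 := by
      refine Finset.sum_eq_zero fun k _ => if_neg ?_
      have := k.2.trans_eq (Fintype.card_fin Nh)
      omega
    rw [this]
    positivity
  exact ⟨Nat.sInf_le hmem, Nat.sInf_mem ⟨Nh, hmem⟩⟩

end Parametric

/-! ### Error estimates in a Euclidean space -/

section Euclidean

variable {E : Type*} [NormedAddCommGroup E] [InnerProductSpace ℝ E] {n : ℕ}

theorem norm_sum_smul_orthonormal {g : Fin n → E} (hg : Orthonormal ℝ g)
    (a : EuclideanSpace ℝ (Fin n)) : ‖∑ j, a j • g j‖ = ‖a‖ := by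
  rw [← sq_eq_sq₀ (norm_nonneg _) (norm_nonneg _), ← real_inner_self_eq_norm_sq, hg.inner_sum,
    EuclideanSpace.norm_sq_eq]
  exact Finset.sum_congr rfl fun i _ => by simp [sq]

theorem norm_inner_orthonormal_le {g : Fin n → E} (hg : Orthonormal ℝ g) (x : E) :
    ‖(WithLp.toLp 2 fun j => inner ℝ (g j) x : EuclideanSpace ℝ (Fin n))‖ ≤ ‖x‖ := by
  rw [← sq_le_sq₀ (norm_nonneg _) (norm_nonneg _), EuclideanSpace.norm_sq_eq]
  exact hg.sum_inner_products_le x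

theorem norm_sub_proj_le {e : Fin n → E} (he : Orthonormal ℝ e) (x : E) :
    ‖x - ∑ j, inner ℝ (e j) x • e j‖ ≤ ‖x‖ := by
  set y := ∑ j, inner ℝ (e j) x • e j with hy
  have h : inner ℝ (x - y) y = 0 := by
    rw [inner_sub_left, sub_eq_zero, hy, he.inner_sum, inner_sum]
    refine Finset.sum_congr rfl fun j _ => ?_
    rw [inner_smul_right, real_inner_comm]
    simp
  have h2 := norm_add_sq_eq_norm_sq_add_norm_sq_real h
  rw [sub_add_cancel] at h2
  nlinarith [norm_nonneg (x - y), norm_nonneg x, norm_nonneg y]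

/-- The error of an approximation in a perturbed orthonormal family with perturbed coefficients is
at most the projection error plus the contributions of the two perturbations. -/
theorem norm_sub_sum_le {e g : Fin n → E} (he : Orthonormal ℝ e) (hg : Orthonormal ℝ g) {κ : ℝ}
    (hge : ∀ j, ‖g j - e j‖ ≤ κ) {x : E} {M : ℝ} (hx : ‖x‖ ≤ M) (φ : EuclideanSpace ℝ (Fin n))
    {β : ℝ} (hφ : ‖φ - WithLp.toLp 2 fun j => inner ℝ (e j) x‖ ≤ β) :
    ‖x - ∑ j, φ j • g j‖ ≤ ‖x - ∑ j, inner ℝ (e j) x • e j‖ + (n * (κ * M) + β) := by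
  set c : EuclideanSpace ℝ (Fin n) := WithLp.toLp 2 fun j => inner ℝ (e j) x with hc
  have hM : 0 ≤ M := (norm_nonneg _).trans hx
  have hsplit : x - ∑ j, φ j • g j = (x - ∑ j, inner ℝ (e j) x • e j) -
      (∑ j, c j • (g j - e j) + ∑ j, (φ - c) j • g j) := by
    simp only [smul_sub, Finset.sum_sub_distrib, PiLp.sub_apply, sub_smul, hc]
    abel
  have h1 : ‖∑ j, c j • (g j - e j)‖ ≤ n * (κ * M) := by
    calc _ ≤ ∑ _j : Fin n, κ * M := by
          refine norm_sum_le_of_le _ fun j _ => ?_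
          rw [norm_smul, mul_comm]
          have : ‖c j‖ ≤ M := by
            refine (norm_inner_le_norm (e j) x).trans ?_
            rw [he.1 j, one_mul]
            exact hx
          exact mul_le_mul (hge j) this (norm_nonneg _) ((norm_nonneg _).trans (hge j))
      _ = _ := by simp
  rw [hsplit]
  refine (norm_sub_le _ _).trans (add_le_add le_rfl ((norm_add_le _ _).trans (add_le_add h1 ?_)))
  rw [norm_sum_smul_orthonormal hg]
  exact hφ

theorem norm_coefficients_sub_le {e e' : Fin n → E} (he : Orthonormal ℝ e) (x x' : E) :
    ‖(WithLp.toLp 2 fun j => inner ℝ (e j) x : EuclideanSpace ℝ (Fin n)) -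
      WithLp.toLp 2 fun j => inner ℝ (e' j) x'‖ ≤
      √(∑ j, ‖e j - e' j‖ ^ 2) * ‖x'‖ + ‖x - x'‖ := by
  have hsplit : (WithLp.toLp 2 fun j => inner ℝ (e j) x : EuclideanSpace ℝ (Fin n)) -
      WithLp.toLp 2 (fun j => inner ℝ (e' j) x') =
      (WithLp.toLp 2 fun j => inner ℝ (e j - e' j) x') +
        WithLp.toLp 2 fun j => inner ℝ (e j) (x - x') := by
    ext j
    simp only [PiLp.sub_apply, PiLp.add_apply, inner_sub_left, inner_sub_right]
    ring
  rw [hsplit]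
  refine (norm_add_le _ _).trans (add_le_add ?_ (norm_inner_orthonormal_le he _))
  rw [EuclideanSpace.norm_eq, ← Real.sqrt_sq (norm_nonneg x'), ← Real.sqrt_mul (by positivity),
    Finset.sum_mul]
  refine Real.sqrt_le_sqrt (Finset.sum_le_sum fun j _ => ?_)
  rw [← mul_pow]
  exact pow_le_pow_left₀ (norm_nonneg _) (norm_inner_le_norm _ _) 2

end Euclidean

theorem abs_norm_sq_sub_le {E : Type*} [NormedAddCommGroup E] {a b : E} {M : ℝ} (ha : ‖a‖ ≤ M)
    (hb : ‖b‖ ≤ M) :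
    |‖a‖ ^ 2 - ‖b‖ ^ 2| ≤ 2 * M * ‖a - b‖ := by
  rw [sq_sub_sq, abs_mul, abs_of_nonneg (by positivity)]
  exact mul_le_mul (by linarith) (abs_norm_sub_norm_le a b) (abs_nonneg _)
    (by linarith [norm_nonneg a])

/-! ### Networks in the parameters and time -/

theorem norm_le_sum_abs {k : ℕ} (x : EuclideanSpace ℝ (Fin k)) : ‖x‖ ≤ ∑ i, |x i| := by
  rw [EuclideanSpace.norm_eq]
  refine Real.sqrt_le_iff.2 ⟨Finset.sum_nonneg fun _ _ => abs_nonneg _, ?_⟩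
  simp only [Real.norm_eq_abs]
  exact Finset.sum_sq_le_sq_sum_of_nonneg fun _ _ => abs_nonneg _

theorem exists_architecture_lipschitz_two (p : ℕ) {R : ℝ} (hR : 0 < R) :
    ∃ C : ℝ, 0 < C ∧ ∀ h ∈ Ioc (0 : ℝ) 1, ∀ m : ℕ, ∃ a : Architecture (p + 1) m, a.depth ≤ 4 ∧
      (a.activeWeights : ℝ) ≤ C * m * h⁻¹ ^ (p + 1) ∧
      ∀ (Θ : Set (EuclideanSpace ℝ (Fin p))) (I : Set ℝ)
        (f : EuclideanSpace ℝ (Fin p) → ℝ → EuclideanSpace ℝ (Fin m)) (Λ : ℝ), 0 ≤ Λ →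
        (∀ μ ∈ Θ, ‖μ‖ ≤ R) → (∀ t ∈ I, |t| ≤ R) →
        (∀ μ₁ ∈ Θ, ∀ μ₂ ∈ Θ, ∀ t₁ ∈ I, ∀ t₂ ∈ I,
          ‖f μ₁ t₁ - f μ₂ t₂‖ ≤ Λ * (‖μ₁ - μ₂‖ + |t₁ - t₂|)) →
        ∃ θ : a.Weights, ∀ μ ∈ Θ, ∀ t ∈ I,
          ‖WithLp.toLp 2 (θ.realize (Fin.append μ ![t])) - f μ t‖ ≤ Λ * (2 * (p + 2) * h) := by
  obtain ⟨C, hC, H⟩ := exists_architecture_lipschitz (p + 1) p.succ_pos hR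
  refine ⟨C, hC, fun h hh m => ?_⟩
  obtain ⟨a, had, haw, ha⟩ := H h hh m
  refine ⟨a, had, haw, fun Θ I f Λ hΛ hΘ hI hf => ?_⟩
  obtain ⟨θ, hθ⟩ := ha {x | ∃ μ ∈ Θ, ∃ t ∈ I, x = Fin.append μ ![t]}
    (fun x => f (WithLp.toLp 2 fun i => x (Fin.castAdd 1 i)) (x (Fin.natAdd p 0))) Λ hΛ
    (by
      rintro _ ⟨μ, hμ, t, ht, rfl⟩ i
      refine Fin.addCases (fun i => ?_) (fun i => ?_) i
      · rw [Fin.append_left]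
        exact (PiLp.norm_apply_le μ i).trans (hΘ μ hμ)
      · rw [Fin.append_right, Matrix.cons_val_fin_one]
        exact hI t ht)
    (by
      rintro _ ⟨μ₁, hμ₁, t₁, ht₁, rfl⟩ _ ⟨μ₂, hμ₂, t₂, ht₂, rfl⟩
      simp only [Fin.append_left, Fin.append_right, Matrix.cons_val_fin_one, Fin.sum_univ_add,
        Fin.sum_univ_one]
      refine (hf μ₁ hμ₁ μ₂ hμ₂ t₁ ht₁ t₂ ht₂).trans (mul_le_mul_of_nonneg_left ?_ hΛ)
      exact add_le_add (norm_le_sum_abs (μ₁ - μ₂)) le_rfl)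
  refine ⟨θ, fun μ hμ t ht => ?_⟩
  have := hθ _ ⟨μ, hμ, t, ht, rfl⟩
  simp only [Fin.append_left, Fin.append_right, Matrix.cons_val_fin_one] at this
  refine this.trans_eq ?_
  push_cast
  ring

theorem exists_architecture_lipschitz_three (p q : ℕ) {R : ℝ} (hR : 0 < R) :
    ∃ C : ℝ, 0 < C ∧ ∀ h ∈ Ioc (0 : ℝ) 1, ∀ m : ℕ, ∃ a : Architecture (p + q + 1) m,
      a.depth ≤ 4 ∧ (a.activeWeights : ℝ) ≤ C * m * h⁻¹ ^ (p + q + 1) ∧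
      ∀ (Θ : Set (EuclideanSpace ℝ (Fin p))) (Θ' : Set (EuclideanSpace ℝ (Fin q))) (I : Set ℝ)
        (f : EuclideanSpace ℝ (Fin p) → EuclideanSpace ℝ (Fin q) → ℝ → EuclideanSpace ℝ (Fin m))
        (Λ : ℝ), 0 ≤ Λ →
        (∀ μ ∈ Θ, ‖μ‖ ≤ R) → (∀ ν ∈ Θ', ‖ν‖ ≤ R) → (∀ t ∈ I, |t| ≤ R) →
        (∀ μ₁ ∈ Θ, ∀ μ₂ ∈ Θ, ∀ ν₁ ∈ Θ', ∀ ν₂ ∈ Θ', ∀ t₁ ∈ I, ∀ t₂ ∈ I,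
          ‖f μ₁ ν₁ t₁ - f μ₂ ν₂ t₂‖ ≤ Λ * (‖μ₁ - μ₂‖ + ‖ν₁ - ν₂‖ + |t₁ - t₂|)) →
        ∃ θ : a.Weights, ∀ μ ∈ Θ, ∀ ν ∈ Θ', ∀ t ∈ I,
          ‖WithLp.toLp 2 (θ.realize (Fin.append (Fin.append μ ν) ![t])) - f μ ν t‖ ≤
            Λ * (2 * (p + q + 2) * h) := by
  obtain ⟨C, hC, H⟩ := exists_architecture_lipschitz (p + q + 1) (p + q).succ_pos hR
  refine ⟨C, hC, fun h hh m => ?_⟩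
  obtain ⟨a, had, haw, ha⟩ := H h hh m
  refine ⟨a, had, haw, fun Θ Θ' I f Λ hΛ hΘ hΘ' hI hf => ?_⟩
  obtain ⟨θ, hθ⟩ := ha
    {x | ∃ μ ∈ Θ, ∃ ν ∈ Θ', ∃ t ∈ I, x = Fin.append (Fin.append μ ν) ![t]}
    (fun x => f (WithLp.toLp 2 fun i => x (Fin.castAdd 1 (Fin.castAdd q i)))
      (WithLp.toLp 2 fun i => x (Fin.castAdd 1 (Fin.natAdd p i))) (x (Fin.natAdd (p + q) 0))) Λ hΛ
    (by
      rintro _ ⟨μ, hμ, ν, hν, t, ht, rfl⟩ i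
      refine Fin.addCases (fun i => ?_) (fun i => ?_) i
      · rw [Fin.append_left]
        refine Fin.addCases (fun i => ?_) (fun i => ?_) i
        · rw [Fin.append_left]
          exact (PiLp.norm_apply_le μ i).trans (hΘ μ hμ)
        · rw [Fin.append_right]
          exact (PiLp.norm_apply_le ν i).trans (hΘ' ν hν)
      · rw [Fin.append_right, Matrix.cons_val_fin_one]
        exact hI t ht)
    (by
      rintro _ ⟨μ₁, hμ₁, ν₁, hν₁, t₁, ht₁, rfl⟩ _ ⟨μ₂, hμ₂, ν₂, hν₂, t₂, ht₂, rfl⟩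
      simp only [Fin.append_left, Fin.append_right, Matrix.cons_val_fin_one, Fin.sum_univ_add,
        Fin.sum_univ_one]
      refine (hf μ₁ hμ₁ μ₂ hμ₂ ν₁ hν₁ ν₂ hν₂ t₁ ht₁ t₂ ht₂).trans
        (mul_le_mul_of_nonneg_left ?_ hΛ)
      exact add_le_add (add_le_add (norm_le_sum_abs (μ₁ - μ₂)) (norm_le_sum_abs (ν₁ - ν₂))) le_rfl)
  refine ⟨θ, fun μ hμ ν hν t ht => ?_⟩
  have := hθ _ ⟨μ, hμ, ν, hν, t, ht, rfl⟩
  simp only [Fin.append_left, Fin.append_right, Matrix.cons_val_fin_one] at this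
  refine this.trans_eq ?_
  push_cast
  ring

/-! ### From pointwise bounds to the relative error -/

/-- The upper half of Tonelli's theorem for three factors, which needs no measurability of `f`. -/
theorem lintegral_prod_le_of_forall {E F : Type*} [MeasureSpace E] [MeasureSpace F]
    [SFinite (volume : Measure E)] [SFinite (volume : Measure F)] {Θ : Set E} {Θ' : Set F}
    {I : Set ℝ} (hΘ : MeasurableSet Θ) (hI : MeasurableSet I) (f : E × F × ℝ → ℝ≥0∞) (B : ℝ≥0∞)
    (h : ∀ μ ∈ Θ, ∀ t ∈ I, ∫⁻ ν in Θ', f (μ, ν, t) ≤ B) :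
    ∫⁻ x in Θ ×ˢ Θ' ×ˢ I, f x ≤ B * volume I * volume Θ := by
  rw [Measure.volume_eq_prod, Measure.volume_eq_prod, ← Measure.prod_restrict,
    ← Measure.prod_restrict]
  refine (lintegral_prod_le _).trans ?_
  calc ∫⁻ μ in Θ, ∫⁻ y, f (μ, y) ∂((volume.restrict Θ').prod (volume.restrict I))
      ≤ ∫⁻ _μ in Θ, B * volume I := by
        refine setLIntegral_mono' hΘ fun μ hμ => ?_
        rw [← lintegral_prod_swap]
        refine (lintegral_prod_le _).trans ?_
        calc _ ≤ ∫⁻ _t in I, B := setLIntegral_mono' hI fun t ht => h μ hμ t ht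
          _ = _ := setLIntegral_const _ _
    _ = _ := setLIntegral_const _ _

section RelativeError

variable {p q Nh : ℕ} {Θ : Set (EuclideanSpace ℝ (Fin p))} {Θ' : Set (EuclideanSpace ℝ (Fin q))}
  {T : ℝ} {G : Matrix (Fin Nh) (Fin Nh) ℝ}
  {u uhat : EuclideanSpace ℝ (Fin p) → EuclideanSpace ℝ (Fin q) → ℝ → Fin Nh → ℝ}

theorem gNorm_nonneg (G : Matrix (Fin Nh) (Fin Nh) ℝ) (x : Fin Nh → ℝ) : 0 ≤ gNorm G x :=
  Real.sqrt_nonneg _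

theorem ae_solutionEssInf_le :
    ∀ᵐ x ∂(volume.restrict (Θ ×ˢ Θ' ×ˢ Icc 0 T) :
        Measure (EuclideanSpace ℝ (Fin p) × EuclideanSpace ℝ (Fin q) × ℝ)),
      solutionEssInf Θ Θ' T G u ≤ gNorm G (u x.1 x.2.1 x.2.2) :=
  ae_essInf_le (Filter.isBoundedUnder_of ⟨0, fun _ => gNorm_nonneg _ _⟩)

theorem volume_domain_ne_zero (hΘ : 0 < volume Θ) (hΘ' : 0 < volume Θ') (hT : 0 < T) :
    (volume.restrict (Θ ×ˢ Θ' ×ˢ Icc 0 T) :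
      Measure (EuclideanSpace ℝ (Fin p) × EuclideanSpace ℝ (Fin q) × ℝ)) ≠ 0 := by
  rw [Ne, Measure.restrict_eq_zero, Measure.volume_eq_prod, Measure.prod_prod,
    Measure.volume_eq_prod, Measure.prod_prod, Real.volume_Icc, sub_zero]
  simp [hΘ.ne', hΘ'.ne', hT]

/-- A solution that varies by at most `D` stays below its essential infimum plus `D + 1`. -/
theorem gNorm_le_essInf_add (hΘ : 0 < volume Θ) (hΘ' : 0 < volume Θ') (hT : 0 < T) {D : ℝ}
    (hm : IsCompact Θ) (hm' : IsCompact Θ')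
    (hD : ∀ μ₁ ∈ Θ, ∀ μ₂ ∈ Θ, ∀ ν₁ ∈ Θ', ∀ ν₂ ∈ Θ', ∀ t₁ ∈ Icc 0 T, ∀ t₂ ∈ Icc 0 T,
      gNorm G (u μ₁ ν₁ t₁) ≤ gNorm G (u μ₂ ν₂ t₂) + D)
    {μ : EuclideanSpace ℝ (Fin p)} (hμ : μ ∈ Θ) {ν : EuclideanSpace ℝ (Fin q)} (hν : ν ∈ Θ')
    {t : ℝ} (ht : t ∈ Icc 0 T) : gNorm G (u μ ν t) ≤ solutionEssInf Θ Θ' T G u + D := by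
  have hne := volume_domain_ne_zero hΘ hΘ' hT
  have : NeZero (volume.restrict (Θ ×ˢ Θ' ×ˢ Icc 0 T) :
      Measure (EuclideanSpace ℝ (Fin p) × EuclideanSpace ℝ (Fin q) × ℝ)) := ⟨hne⟩
  have hmeas : MeasurableSet (Θ ×ˢ Θ' ×ˢ Icc 0 T) :=
    hm.measurableSet.prod (hm'.measurableSet.prod measurableSet_Icc)
  rw [← sub_le_iff_le_add]
  refine le_essInf_of_ae_le _ ?_ ?_
  · refine (ae_restrict_iff' hmeas).2 (Filter.Eventually.of_forall fun x hx => ?_)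
    have := hD μ hμ _ hx.1 ν hν _ hx.2.1 t ht _ hx.2.2
    linarith
  · refine Filter.IsBoundedUnder.isCoboundedUnder_ge ⟨gNorm G (u μ ν t) + D,
      Filter.eventually_map.2 ?_⟩
    exact (ae_restrict_iff' hmeas).2 (Filter.Eventually.of_forall fun x hx =>
      hD _ hx.1 μ hμ _ hx.2.1 ν hν _ hx.2.2 t ht)

/-- If the error is bounded by `a + b`, where `a` is small in the mean square sense for all `(μ, t)`
and `b` is uniformly small, then the relative error is small. -/
theorem relativeError_lt (hΘ : IsCompact Θ) (hΘ' : IsCompact Θ') (hΘ_vol : 0 < volume Θ)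
    (hT : 0 < T) {m ε b : ℝ} (hm : 0 < m) (hε : 0 < ε) (hmu : solutionEssInf Θ Θ' T G u = m)
    (a : EuclideanSpace ℝ (Fin p) → EuclideanSpace ℝ (Fin q) → ℝ → ℝ)
    (hab : ∀ μ ∈ Θ, ∀ ν ∈ Θ', ∀ t ∈ Icc 0 T,
      gNorm G (u μ ν t - uhat μ ν t) ≤ a μ ν t + b)
    (ha : ∀ μ ∈ Θ, ∀ t ∈ Icc 0 T, ∫⁻ ν in Θ', ENNReal.ofReal (a μ ν t ^ 2) ≤
      ENNReal.ofReal (m ^ 2 * ε ^ 2 / (8 * (volume.real Θ * T))))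
    (hb : 8 * (b ^ 2 * (volume.real Θ * volume.real Θ' * T)) ≤ m ^ 2 * ε ^ 2) :
    relativeError Θ Θ' T G u uhat < ENNReal.ofReal ε := by
  have hV : 0 < volume.real Θ := ENNReal.toReal_pos hΘ_vol.ne' hΘ.measure_lt_top.ne
  have hV' : 0 ≤ volume.real Θ' := measureReal_nonneg
  have hmeas : MeasurableSet (Θ ×ˢ Θ' ×ˢ Icc 0 T) :=
    hΘ.measurableSet.prod (hΘ'.measurableSet.prod measurableSet_Icc)
  set B : ℝ := 2 / m ^ 2 * (m ^ 2 * ε ^ 2 / (8 * (volume.real Θ * T))) +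
    2 / m ^ 2 * b ^ 2 * volume.real Θ' with hB
  have hB0 : 0 ≤ B := by positivity
  have hle : ∫⁻ x : EuclideanSpace ℝ (Fin p) × EuclideanSpace ℝ (Fin q) × ℝ in
      Θ ×ˢ Θ' ×ˢ Icc 0 T, ENNReal.ofReal (gNorm G (u x.1 x.2.1 x.2.2 - uhat x.1 x.2.1 x.2.2) ^ 2
        / gNorm G (u x.1 x.2.1 x.2.2) ^ 2) ≤ ENNReal.ofReal (B * T * volume.real Θ) := by
    calc _ ≤ ∫⁻ x : EuclideanSpace ℝ (Fin p) × EuclideanSpace ℝ (Fin q) × ℝ in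
          Θ ×ˢ Θ' ×ˢ Icc 0 T, (ENNReal.ofReal (2 / m ^ 2) *
            ENNReal.ofReal (a x.1 x.2.1 x.2.2 ^ 2) + ENNReal.ofReal (2 / m ^ 2 * b ^ 2)) := by
          refine lintegral_mono_ae ?_
          filter_upwards [ae_solutionEssInf_le (G := G) (u := u), ae_restrict_mem hmeas]
            with x hx hxm
          rw [hmu] at hx
          rw [← ENNReal.ofReal_mul (by positivity), ← ENNReal.ofReal_add (by positivity)
            (by positivity)]
          refine ENNReal.ofReal_le_ofReal ?_
          have h1 := hab _ hxm.1 _ hxm.2.1 _ hxm.2.2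
          have h0 := gNorm_nonneg G (u x.1 x.2.1 x.2.2 - uhat x.1 x.2.1 x.2.2)
          calc _ ≤ gNorm G (u x.1 x.2.1 x.2.2 - uhat x.1 x.2.1 x.2.2) ^ 2 / m ^ 2 := by gcongr
            _ ≤ (2 * (a x.1 x.2.1 x.2.2 ^ 2 + b ^ 2)) / m ^ 2 := by
                gcongr
                exact (pow_le_pow_left₀ h0 h1 2).trans add_sq_le
            _ = _ := by ring
      _ ≤ ENNReal.ofReal B * volume (Icc 0 T) * volume Θ := by
          refine lintegral_prod_le_of_forall hΘ.measurableSet measurableSet_Icc _ _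
            fun μ hμ t ht => ?_
          simp only
          rw [lintegral_add_right _ measurable_const, setLIntegral_const,
            lintegral_const_mul' _ _ ENNReal.ofReal_ne_top, hB,
            ENNReal.ofReal_add (by positivity) (by positivity),
            ENNReal.ofReal_mul (p := 2 / m ^ 2)
              (q := m ^ 2 * ε ^ 2 / (8 * (volume.real Θ * T))) (by positivity),
            ENNReal.ofReal_mul (p := 2 / m ^ 2 * b ^ 2) (by positivity),
            ofReal_measureReal hΘ'.measure_lt_top.ne]
          gcongr
          exact ha μ hμ t ht
      _ = _ := by
          rw [Real.volume_Icc, sub_zero, ← ofReal_measureReal hΘ.measure_lt_top.ne,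
            ← ENNReal.ofReal_mul hB0, ← ENNReal.ofReal_mul (by positivity)]
  have hlt : B * T * volume.real Θ < ε ^ 2 := by
    have e1 : B * T * volume.real Θ =
        ε ^ 2 / 4 + 2 * (b ^ 2 * (volume.real Θ * volume.real Θ' * T)) / m ^ 2 := by
      rw [hB]
      field_simp
      ring
    have e2 : 2 * (b ^ 2 * (volume.real Θ * volume.real Θ' * T)) / m ^ 2 ≤ ε ^ 2 / 4 := by
      rw [div_le_iff₀ (by positivity)]
      linarith
    have : 0 < ε ^ 2 := by positivity
    linarith
  calc relativeError Θ Θ' T G u uhat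
      ≤ ENNReal.ofReal (B * T * volume.real Θ) ^ (1 / 2 : ℝ) :=
        ENNReal.rpow_le_rpow hle (by norm_num)
    _ < ENNReal.ofReal (ε ^ 2) ^ (1 / 2 : ℝ) :=
        ENNReal.rpow_lt_rpow ((ENNReal.ofReal_lt_ofReal_iff (by positivity)).2 hlt) (by norm_num)
    _ = ENNReal.ofReal ε := by
        rw [ENNReal.ofReal_rpow_of_nonneg (by positivity) (by norm_num), ← Real.sqrt_eq_rpow,
          Real.sqrt_sq hε.le]

end RelativeError

/-! ### The networks of a fixed sample -/

section Sample

variable {p q Nh N n : ℕ} {Θ : Set (EuclideanSpace ℝ (Fin p))} {Θ' : Set (EuclideanSpace ℝ (Fin q))}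
  {T : ℝ} {G A : Matrix (Fin Nh) (Fin Nh) ℝ}
  {u : EuclideanSpace ℝ (Fin p) → EuclideanSpace ℝ (Fin q) → ℝ → Fin Nh → ℝ}
  {ν : Fin N → EuclideanSpace ℝ (Fin q)}

/-- The coordinates of the solution with respect to the columns of `A`. -/
noncomputable def coords (G A : Matrix (Fin Nh) (Fin Nh) ℝ)
    (u : EuclideanSpace ℝ (Fin p) → EuclideanSpace ℝ (Fin q) → ℝ → Fin Nh → ℝ)
    (μ : EuclideanSpace ℝ (Fin p)) (ν : EuclideanSpace ℝ (Fin q)) (t : ℝ) :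
    EuclideanSpace ℝ (Fin Nh) :=
  WithLp.toLp 2 ((Aᵀ * G) *ᵥ u μ ν t)

theorem norm_coords (hA : GOrthonormal G A) (μ : EuclideanSpace ℝ (Fin p))
    (ν : EuclideanSpace ℝ (Fin q)) (t : ℝ) : ‖coords G A u μ ν t‖ = gNorm G (u μ ν t) :=
  (gNorm_eq_norm_coordinates hA _).symm

theorem norm_coords_sub (hA : GOrthonormal G A) (μ₁ μ₂ : EuclideanSpace ℝ (Fin p))
    (ν₁ ν₂ : EuclideanSpace ℝ (Fin q)) (t₁ t₂ : ℝ) :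
    ‖coords G A u μ₁ ν₁ t₁ - coords G A u μ₂ ν₂ t₂‖ = gNorm G (u μ₁ ν₁ t₁ - u μ₂ ν₂ t₂) := by
  rw [gNorm_eq_norm_coordinates hA, Matrix.mulVec_sub, WithLp.toLp_sub]
  rfl

/-- A uniform bound on the solution in terms of the data on which the constants may depend. -/
theorem gNorm_le_of_lipschitz (hA : GOrthonormal G A) (hΘ : IsCompact Θ) (hΘ' : IsCompact Θ')
    (hΘ_vol : 0 < volume Θ) (hΘ_vol' : 0 < volume Θ') (hT : 0 < T) {L R : ℝ} (hL : 0 ≤ L)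
    (hu : LipschitzSolution Θ Θ' T G u L) (hR : ∀ μ ∈ Θ, ‖μ‖ ≤ R) (hR' : ∀ ν ∈ Θ', ‖ν‖ ≤ R)
    (hRT : T ≤ R) {μ : EuclideanSpace ℝ (Fin p)} (hμ : μ ∈ Θ) {ν : EuclideanSpace ℝ (Fin q)}
    (hν : ν ∈ Θ') {t : ℝ} (ht : t ∈ Icc 0 T) :
    gNorm G (u μ ν t) ≤ solutionEssInf Θ Θ' T G u + L * (5 * R) := by
  refine gNorm_le_essInf_add hΘ_vol hΘ_vol' hT hΘ hΘ' ?_ hμ hν ht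
  intro μ₁ hμ₁ μ₂ hμ₂ ν₁ hν₁ ν₂ hν₂ t₁ ht₁ t₂ ht₂
  have h1 := hu μ₁ hμ₁ μ₂ hμ₂ ν₁ hν₁ ν₂ hν₂ t₁ ht₁ t₂ ht₂
  rw [← norm_coords_sub hA] at h1
  rw [← norm_coords hA, ← norm_coords hA]
  have h2 : ‖μ₁ - μ₂‖ + ‖ν₁ - ν₂‖ + |t₁ - t₂| ≤ 5 * R := by
    have a1 := norm_sub_le μ₁ μ₂
    have a2 := norm_sub_le ν₁ ν₂
    have a3 : |t₁ - t₂| ≤ T := abs_le.2 ⟨by linarith [ht₁.1, ht₂.2], by linarith [ht₁.2, ht₂.1]⟩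
    linarith [hR μ₁ hμ₁, hR μ₂ hμ₂, hR' ν₁ hν₁, hR' ν₂ hν₂]
  have h3 := norm_le_norm_sub_add (coords G A u μ₁ ν₁ t₁) (coords G A u μ₂ ν₂ t₂)
  have h4 := mul_le_mul_of_nonneg_left h2 hL
  linarith

/-- The norm of the projection error onto the span of the columns of the optimal DOD. -/
noncomputable def projError (G A : Matrix (Fin Nh) (Fin Nh) ℝ)
    (u : EuclideanSpace ℝ (Fin p) → EuclideanSpace ℝ (Fin q) → ℝ → Fin Nh → ℝ)
    (s : EuclideanSpace ℝ (Fin p) → ℝ → Matrix (Fin Nh) (Fin n) ℝ)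
    (μ : EuclideanSpace ℝ (Fin p)) (ν : EuclideanSpace ℝ (Fin q)) (t : ℝ) : ℝ :=
  ‖coords G A u μ ν t - ∑ j, inner ℝ (euclideanCol (s μ t) j) (coords G A u μ ν t) •
    euclideanCol (s μ t) j‖

theorem objective_eq_sum_projError (hA : GOrthonormal G A)
    (s : EuclideanSpace ℝ (Fin p) → ℝ → Matrix (Fin Nh) (Fin n) ℝ)
    (μ : EuclideanSpace ℝ (Fin p)) (t : ℝ) :
    objective Θ' G u ν μ t (A * s μ t) =
      volume.real Θ' / N * ∑ i, projError G A u s μ (ν i) t ^ 2 := by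
  rw [objective_mul_eq hA]
  simp only [toLp_sub_proj_eq]
  rfl

theorem IsOptimalDOD.orthonormal (hA : GOrthonormal G A)
    {s : EuclideanSpace ℝ (Fin p) → ℝ → Matrix (Fin Nh) (Fin n) ℝ}
    (hs : IsOptimalDOD Θ Θ' T G u A ν s) {μ : EuclideanSpace ℝ (Fin p)} (hμ : μ ∈ Θ) {t : ℝ}
    (ht : t ∈ Icc 0 T) : Orthonormal ℝ (euclideanCol (s μ t)) :=
  (orthonormal_euclideanCol_iff _).2 ((gOrthonormal_mul_iff hA _).1 (hs μ hμ t ht).2.1)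

theorem LipschitzDOD.sqrt_sum_le {s : EuclideanSpace ℝ (Fin p) → ℝ → Matrix (Fin Nh) (Fin n) ℝ}
    {K : ℝ} (hs : LipschitzDOD Θ T s K) {μ₁ μ₂ : EuclideanSpace ℝ (Fin p)} (h₁ : μ₁ ∈ Θ)
    (h₂ : μ₂ ∈ Θ) {t₁ t₂ : ℝ} (ht₁ : t₁ ∈ Icc 0 T) (ht₂ : t₂ ∈ Icc 0 T) :
    √(∑ j, ‖euclideanCol (s μ₁ t₁) j - euclideanCol (s μ₂ t₂) j‖ ^ 2) ≤
      K * (‖μ₁ - μ₂‖ + |t₁ - t₂|) := by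
  refine le_trans (le_of_eq ?_) (hs μ₁ h₁ μ₂ h₂ t₁ ht₁ t₂ ht₂)
  rw [Finset.sum_comm]
  congr 1
  refine Finset.sum_congr rfl fun j _ => ?_
  rw [EuclideanSpace.norm_sq_eq]
  exact Finset.sum_congr rfl fun i _ => by simp [euclideanCol]

theorem LipschitzDOD.norm_col_sub_le
    {s : EuclideanSpace ℝ (Fin p) → ℝ → Matrix (Fin Nh) (Fin n) ℝ}
    {K : ℝ} (hs : LipschitzDOD Θ T s K) {μ₁ μ₂ : EuclideanSpace ℝ (Fin p)} (h₁ : μ₁ ∈ Θ)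
    (h₂ : μ₂ ∈ Θ) {t₁ t₂ : ℝ} (ht₁ : t₁ ∈ Icc 0 T) (ht₂ : t₂ ∈ Icc 0 T) (j : Fin n) :
    ‖euclideanCol (s μ₁ t₁) j - euclideanCol (s μ₂ t₂) j‖ ≤ K * (‖μ₁ - μ₂‖ + |t₁ - t₂|) := by
  refine le_trans (Real.le_sqrt_of_sq_le ?_) (hs.sqrt_sum_le h₁ h₂ ht₁ ht₂)
  exact Finset.single_le_sum
    (f := fun j => ‖euclideanCol (s μ₁ t₁) j - euclideanCol (s μ₂ t₂) j‖ ^ 2)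
    (fun _ _ => sq_nonneg _) (Finset.mem_univ j)

/-- The coefficients of the solution in an optimal DOD are Lipschitz, with a constant that does not
depend on the dimension. -/
theorem norm_coefficients_lipschitz (hA : GOrthonormal G A) {L K M : ℝ} (hK : 0 ≤ K)
    (hu : LipschitzSolution Θ Θ' T G u L)
    (hM : ∀ μ ∈ Θ, ∀ ν ∈ Θ', ∀ t ∈ Icc 0 T, gNorm G (u μ ν t) ≤ M)
    {s : EuclideanSpace ℝ (Fin p) → ℝ → Matrix (Fin Nh) (Fin n) ℝ}
    (hs : IsOptimalDOD Θ Θ' T G u A ν s) (hsL : LipschitzDOD Θ T s K) :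
    ∀ μ₁ ∈ Θ, ∀ μ₂ ∈ Θ, ∀ ν₁ ∈ Θ', ∀ ν₂ ∈ Θ', ∀ t₁ ∈ Icc 0 T, ∀ t₂ ∈ Icc 0 T,
      ‖(WithLp.toLp 2 fun j => inner ℝ (euclideanCol (s μ₁ t₁) j) (coords G A u μ₁ ν₁ t₁) :
          EuclideanSpace ℝ (Fin n)) -
        WithLp.toLp 2 fun j => inner ℝ (euclideanCol (s μ₂ t₂) j) (coords G A u μ₂ ν₂ t₂)‖ ≤
      (K * M + L) * (‖μ₁ - μ₂‖ + ‖ν₁ - ν₂‖ + |t₁ - t₂|) := by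
  intro μ₁ hμ₁ μ₂ hμ₂ ν₁ hν₁ ν₂ hν₂ t₁ ht₁ t₂ ht₂
  refine (norm_coefficients_sub_le (hs.orthonormal hA hμ₁ ht₁) _ _).trans ?_
  rw [norm_coords_sub hA, norm_coords hA, add_mul]
  refine add_le_add ?_ (hu μ₁ hμ₁ μ₂ hμ₂ ν₁ hν₁ ν₂ hν₂ t₁ ht₁ t₂ ht₂)
  have hM2 := hM μ₂ hμ₂ ν₂ hν₂ t₂ ht₂
  have hM0 := (gNorm_nonneg _ _).trans hM2
  calc _ ≤ K * (‖μ₁ - μ₂‖ + |t₁ - t₂|) * M :=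
        mul_le_mul (hsL.sqrt_sum_le hμ₁ hμ₂ ht₁ ht₂) hM2 (gNorm_nonneg _ _) (by positivity)
    _ = K * M * (‖μ₁ - μ₂‖ + 0 + |t₁ - t₂|) := by ring
    _ ≤ _ := by
        gcongr
        exact norm_nonneg _

theorem projError_le (hA : GOrthonormal G A) {M : ℝ}
    (hM : ∀ μ ∈ Θ, ∀ ν ∈ Θ', ∀ t ∈ Icc 0 T, gNorm G (u μ ν t) ≤ M)
    {s : EuclideanSpace ℝ (Fin p) → ℝ → Matrix (Fin Nh) (Fin n) ℝ}
    (hs : IsOptimalDOD Θ Θ' T G u A ν s) {μ : EuclideanSpace ℝ (Fin p)} (hμ : μ ∈ Θ)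
    {ν' : EuclideanSpace ℝ (Fin q)} (hν : ν' ∈ Θ') {t : ℝ} (ht : t ∈ Icc 0 T) :
    projError G A u s μ ν' t ≤ M :=
  (norm_sub_proj_le (hs.orthonormal hA hμ ht) _).trans
    ((norm_coords hA _ _ _).trans_le (hM μ hμ ν' hν t ht))

theorem projError_sq_lipschitz (hA : GOrthonormal G A) {L M : ℝ}
    (hu : LipschitzSolution Θ Θ' T G u L)
    (hM : ∀ μ ∈ Θ, ∀ ν ∈ Θ', ∀ t ∈ Icc 0 T, gNorm G (u μ ν t) ≤ M)
    {s : EuclideanSpace ℝ (Fin p) → ℝ → Matrix (Fin Nh) (Fin n) ℝ}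
    (hs : IsOptimalDOD Θ Θ' T G u A ν s) {μ : EuclideanSpace ℝ (Fin p)} (hμ : μ ∈ Θ) {t : ℝ}
    (ht : t ∈ Icc 0 T) {ν₁ ν₂ : EuclideanSpace ℝ (Fin q)} (h₁ : ν₁ ∈ Θ') (h₂ : ν₂ ∈ Θ') :
    |projError G A u s μ ν₁ t ^ 2 - projError G A u s μ ν₂ t ^ 2| ≤ 2 * M * L * dist ν₁ ν₂ := by
  have b₁ := projError_le hA hM hs hμ h₁ ht
  have b₂ := projError_le hA hM hs hμ h₂ ht
  have h0 : 0 ≤ projError G A u s μ ν₁ t := norm_nonneg _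
  have hM0 : 0 ≤ M := h0.trans b₁
  refine (abs_norm_sq_sub_le b₁ b₂).trans ?_
  rw [mul_assoc (2 * M)]
  refine mul_le_mul_of_nonneg_left ?_ (by positivity)
  have he := hs.orthonormal hA hμ ht
  have h := norm_sub_proj_le he (coords G A u μ ν₁ t - coords G A u μ ν₂ t)
  have e : coords G A u μ ν₁ t - ∑ j, inner ℝ (euclideanCol (s μ t) j) (coords G A u μ ν₁ t) •
      euclideanCol (s μ t) j - (coords G A u μ ν₂ t - ∑ j, inner ℝ (euclideanCol (s μ t) j)
      (coords G A u μ ν₂ t) • euclideanCol (s μ t) j) =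
      coords G A u μ ν₁ t - coords G A u μ ν₂ t - ∑ j, inner ℝ (euclideanCol (s μ t) j)
        (coords G A u μ ν₁ t - coords G A u μ ν₂ t) • euclideanCol (s μ t) j := by
    simp only [inner_sub_right, sub_smul, Finset.sum_sub_distrib]
    abel
  rw [e]
  refine h.trans ?_
  rw [norm_coords_sub hA, dist_eq_norm]
  simpa using hu μ hμ μ hμ ν₁ h₁ ν₂ h₂ t ht t ht

/-- If the branches of an inner DOD module are close to the columns of an optimal DOD, the
orthonormalized columns are orthonormal and still close to them. -/
theorem DODArchitecture.Weights.realize_close (hA : GOrthonormal G A)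
    {s : EuclideanSpace ℝ (Fin p) → ℝ → Matrix (Fin Nh) (Fin n) ℝ}
    (hs : IsOptimalDOD Θ Θ' T G u A ν s) {η : ℝ}
    {a : DODArchitecture (p + 1) Nh n} (θ : a.Weights) (hη : 0 ≤ η) (hη1 : 8 ^ n * η < 1)
    {μ : EuclideanSpace ℝ (Fin p)} (hμ : μ ∈ Θ) {t : ℝ} (ht : t ∈ Icc 0 T) {x : Fin (p + 1) → ℝ}
    (hθ : ∀ j, ‖WithLp.toLp 2 ((θ.root j).realize (θ.seed.realize x)) - euclideanCol (s μ t) j‖ ≤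
      η) :
    Orthonormal ℝ (euclideanCol (θ.realize x)) ∧
      ∀ j, ‖euclideanCol (θ.realize x) j - euclideanCol (s μ t) j‖ ≤ 2 * 8 ^ n * η := by
  have e : euclideanCol (θ.realize x) =
      InnerProductSpace.gramSchmidtNormed ℝ fun j => WithLp.toLp 2
        ((θ.root j).realize (θ.seed.realize x)) :=
    funext fun j => euclideanCol_orth _ j
  rw [e]
  exact gramSchmidtNormed_stable (hs.orthonormal hA hμ ht) hη hη1 hθ

/-- The error of an approximation whose basis is close to an optimal DOD, and whose coefficients are
close to those of the solution. -/
theorem gNorm_sub_mulVec_le (hA : GOrthonormal G A) {M κ β : ℝ}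
    {s : EuclideanSpace ℝ (Fin p) → ℝ → Matrix (Fin Nh) (Fin n) ℝ}
    (W : Matrix (Fin Nh) (Fin n) ℝ) (φ : Fin n → ℝ) {μ : EuclideanSpace ℝ (Fin p)}
    {ν : EuclideanSpace ℝ (Fin q)} {t : ℝ} (hM : gNorm G (u μ ν t) ≤ M)
    (he : Orthonormal ℝ (euclideanCol (s μ t))) (h1 : Orthonormal ℝ (euclideanCol W))
    (h2 : ∀ j, ‖euclideanCol W j - euclideanCol (s μ t) j‖ ≤ κ)
    (hφ : ‖WithLp.toLp 2 φ -
        WithLp.toLp 2 fun j => inner ℝ (euclideanCol (s μ t) j) (coords G A u μ ν t)‖ ≤ β) :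
    gNorm G (u μ ν t - (A * W) *ᵥ φ) ≤ projError G A u s μ ν t + (n * (κ * M) + β) := by
  have e : u μ ν t - (A * W) *ᵥ φ = A *ᵥ ((Aᵀ * G) *ᵥ u μ ν t - W *ᵥ φ) := by
    rw [Matrix.mulVec_sub, mulVec_coordinates hA, Matrix.mulVec_mulVec]
  have hx := (norm_coords (u := u) hA μ ν t).trans_le hM
  rw [e, gNorm_mulVec hA, WithLp.toLp_sub, toLp_mulVec_eq_sum W]
  exact norm_sub_sum_le he h1 h2 hx (WithLp.toLp 2 φ) hφ

end Sample

/-! ### The mean square projection error of a sample -/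

theorem setLIntegral_eq_mul_cond {E : Type*} [MeasureSpace E] {K : Set E} (hK : MeasurableSet K)
    (h0 : volume K ≠ 0) (h1 : volume K ≠ ∞) (f : E → ℝ≥0∞) :
    ∫⁻ x in K, f x = volume K * ∫⁻ x in K, f x ∂(ProbabilityTheory.cond volume K) := by
  rw [ProbabilityTheory.cond, Measure.restrict_smul, Measure.restrict_restrict hK, inter_self,
    lintegral_smul_measure, smul_eq_mul, ← mul_assoc, ENNReal.mul_inv_cancel h0 h1, one_mul]

/-- For a sample that obeys the uniform law of large numbers, the mean square projection error is at
most twice the bound `ζ` on the tail of the eigenvalues. -/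
theorem lintegral_projError_le {p q Nh N n : ℕ} {Θ : Set (EuclideanSpace ℝ (Fin p))}
    {Θ' : Set (EuclideanSpace ℝ (Fin q))} {T : ℝ} {G A : Matrix (Fin Nh) (Fin Nh) ℝ}
    {u : EuclideanSpace ℝ (Fin p) → EuclideanSpace ℝ (Fin q) → ℝ → Fin Nh → ℝ}
    {ν : Fin N → EuclideanSpace ℝ (Fin q)} (hA : GOrthonormal G A) (hΘ' : IsCompact Θ')
    (hΘ_vol' : 0 < volume Θ') {M L : ℝ} (hu : LipschitzSolution Θ Θ' T G u L)
    (hM : ∀ μ ∈ Θ, ∀ ν ∈ Θ', ∀ t ∈ Icc 0 T, gNorm G (u μ ν t) ≤ M)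
    {s : EuclideanSpace ℝ (Fin p) → ℝ → Matrix (Fin Nh) (Fin n) ℝ}
    (hs : IsOptimalDOD Θ Θ' T G u A ν s) (hn : n ≤ Nh) {ζ τ : ℝ}
    (htail : ∀ μ ∈ Θ, ∀ t ∈ Icc 0 T, eigenvalueTail Θ' G u A ν μ t n ≤ ζ)
    (hτ : volume.real Θ' * τ ≤ ζ)
    (hν : ∀ F : EuclideanSpace ℝ (Fin q) → ℝ, (∀ x ∈ Θ', F x ∈ Icc 0 (M ^ 2)) →
      (∀ x ∈ Θ', ∀ y ∈ Θ', |F x - F y| ≤ 2 * M * L * dist x y) →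
      ∫⁻ x in Θ', ENNReal.ofReal (F x) ∂(ProbabilityTheory.cond volume Θ') ≤
        ENNReal.ofReal ((∑ i, F (ν i)) / N + τ))
    {μ : EuclideanSpace ℝ (Fin p)} (hμ : μ ∈ Θ) {t : ℝ} (ht : t ∈ Icc 0 T) :
    ∫⁻ ν' in Θ', ENNReal.ofReal (projError G A u s μ ν' t ^ 2) ≤ ENNReal.ofReal (2 * ζ) := by
  have h := hν (fun ν' => projError G A u s μ ν' t ^ 2)
    (fun x hx => ⟨sq_nonneg _, pow_le_pow_left₀ (norm_nonneg _) (projError_le hA hM hs hμ hx ht)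
      2⟩)
    (fun x hx y hy => projError_sq_lipschitz hA hu hM hs hμ ht hx hy)
  rw [setLIntegral_eq_mul_cond hΘ'.measurableSet hΘ_vol'.ne' hΘ'.measure_lt_top.ne]
  calc _ ≤ volume Θ' * ENNReal.ofReal ((∑ i, projError G A u s μ (ν i) t ^ 2) / N + τ) := by gcongr
    _ = ENNReal.ofReal (volume.real Θ' * ((∑ i, projError G A u s μ (ν i) t ^ 2) / N + τ)) := by
        rw [ENNReal.ofReal_mul measureReal_nonneg, ofReal_measureReal hΘ'.measure_lt_top.ne]
    _ ≤ _ := by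
        refine ENNReal.ofReal_le_ofReal ?_
        have h1 := (hs.objective_le hA hn hμ ht).trans (htail μ hμ t ht)
        rw [objective_eq_sum_projError hA] at h1
        have h2 : volume.real Θ' * ((∑ i, projError G A u s μ (ν i) t ^ 2) / N + τ) =
            volume.real Θ' / N * (∑ i, projError G A u s μ (ν i) t ^ 2) + volume.real Θ' * τ := by
          ring
        rw [h2]
        linarith

/-- Samples with an almost sure property may be selected in a measurable set, at no cost. -/
theorem exists_measurableSet_of_ae {Ω : Type*} [MeasurableSpace Ω] (P : Measure Ω)
    [IsProbabilityMeasure P] {δ : ℝ} (hδ : δ ∈ Ioo (0 : ℝ) 1) {S : Set Ω} (hS : MeasurableSet S)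
    (hPS : P Sᶜ < ENNReal.ofReal δ) {H : Ω → Prop} (hH : ∀ᵐ ω ∂P, H ω) :
    ∃ S' : Set Ω, MeasurableSet S' ∧ ENNReal.ofReal (1 - δ) < P S' ∧ ∀ ω ∈ S', ω ∈ S ∧ H ω := by
  obtain ⟨t, ht, htm, ht0⟩ := exists_measurable_superset_of_null (ae_iff.1 hH)
  refine ⟨S \ t, hS.diff htm, ?_, fun ω hω => ⟨hω.1, ?_⟩⟩
  · rw [measure_sdiff_null ht0]
    by_contra! h
    have h1 : P S + P Sᶜ = 1 := prob_add_prob_compl hS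
    have h2 : P S + P Sᶜ < ENNReal.ofReal (1 - δ) + ENNReal.ofReal δ :=
      ENNReal.add_lt_add_of_le_of_lt (measure_ne_top _ _) h hPS
    rw [h1, ← ENNReal.ofReal_add (by linarith [hδ.2]) hδ.1.le, sub_add_cancel,
      ENNReal.ofReal_one] at h2
    exact lt_irrefl _ h2
  · by_contra h
    exact hω.2 (ht h)

theorem exists_scale {Q b : ℝ} (hQ : 0 ≤ Q) (hb : 0 < b) : ∃ κ ∈ Ioc (0 : ℝ) 1, Q * κ ≤ b := by
  refine ⟨b / (b + Q), ⟨by positivity, (div_le_one (by positivity)).2 (by linarith)⟩, ?_⟩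
  rw [mul_div_assoc', div_le_iff₀ (by positivity)]
  nlinarith

/-- In dimension zero the essential infimum of the norm of the solution vanishes. -/
theorem dim_pos_of_essInf {p q Nh : ℕ} {Θ : Set (EuclideanSpace ℝ (Fin p))}
    {Θ' : Set (EuclideanSpace ℝ (Fin q))} {T : ℝ} {G : Matrix (Fin Nh) (Fin Nh) ℝ}
    {u : EuclideanSpace ℝ (Fin p) → EuclideanSpace ℝ (Fin q) → ℝ → Fin Nh → ℝ}
    (hΘ : 0 < volume Θ) (hΘ' : 0 < volume Θ') (hT : 0 < T)
    (h : 0 < solutionEssInf Θ Θ' T G u) : 0 < Nh := by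
  rcases Nat.eq_zero_or_pos Nh with rfl | h0
  · refine absurd h (not_lt.2 (le_of_eq ?_))
    have : ∀ x : EuclideanSpace ℝ (Fin p) × EuclideanSpace ℝ (Fin q) × ℝ,
        gNorm G (u x.1 x.2.1 x.2.2) = 0 := fun x => by simp [gNorm]
    unfold solutionEssInf
    simp only [this]
    exact essInf_const _ (volume_domain_ne_zero hΘ hΘ' hT)
  · exact h0

end DODROM

open DODROM in
theorem mainTheorem2 (p q : ℕ)
    (Θ : Set (EuclideanSpace ℝ (Fin p))) (Θ' : Set (EuclideanSpace ℝ (Fin q)))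
    (hΘ : IsCompact Θ) (hΘ' : IsCompact Θ') (hΘ_vol : 0 < volume Θ) (hΘ_vol' : 0 < volume Θ')
    (T : ℝ) (hT : 0 < T) (L : ℝ) (hL : 0 < L) (Lhat : ℝ) (hLhat : 0 < Lhat)
    (m : ℝ) (hm : 0 < m) (ε₀ : ℝ) (hε₀ : ε₀ ∈ Ioo (0 : ℝ) 1) :
    ∃ c : ℕ → ℝ, (∀ n, 0 < c n) ∧
      ∀ (Nh NA : ℕ), NA = Nh →
      ∀ G : Matrix (Fin Nh) (Fin Nh) ℝ, G.PosDef →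
      ∀ u : EuclideanSpace ℝ (Fin p) → EuclideanSpace ℝ (Fin q) → ℝ → Fin Nh → ℝ,
        DODROM.LipschitzSolution Θ Θ' T G u L →
        DODROM.solutionEssInf Θ Θ' T G u = m →
      ∀ ε ∈ Ioc (0 : ℝ) ε₀, ∀ δ ∈ Ioo (0 : ℝ) 1,
      ∃ (N₀ : ℕ) (archDOD : (n : ℕ) → DODROM.DODArchitecture (p + 1) NA n)
        (archDF : (n : ℕ) → DODROM.Architecture (p + q + 1) n),
        (∀ n : ℕ,
          ((archDOD n).layers : ℝ) ≤ c n * Real.log ε⁻¹ ∧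
          ((archDOD n).activeWeights : ℝ)
            ≤ c n * NA * n * ε⁻¹ ^ (p + 1) * Real.log ε⁻¹ ∧
          ((archDF n).depth : ℝ) ≤ c n * Real.log ε⁻¹ ∧
          ((archDF n).activeWeights : ℝ)
            ≤ c n * n * ε⁻¹ ^ (p + q + 1) * Real.log ε⁻¹) ∧
        ∀ N : ℕ, N₀ ≤ N →
        ∀ A : (Fin N → EuclideanSpace ℝ (Fin q)) → Matrix (Fin Nh) (Fin NA) ℝ,
          (∀ ν, DODROM.GOrthonormal G (A ν)) →
          (∀ᵐ ν ∂(DODROM.sampleLaw Θ' N),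
            ∃ s : EuclideanSpace ℝ (Fin p) → ℝ →
                Matrix (Fin NA) (Fin (DODROM.reducedDim Θ Θ' T G u (A ν) ν ε)) ℝ,
              DODROM.IsOptimalDOD Θ Θ' T G u (A ν) ν s ∧ DODROM.LipschitzDOD Θ T s Lhat) →
          ∃ S : Set (Fin N → EuclideanSpace ℝ (Fin q)), MeasurableSet S ∧
            ENNReal.ofReal (1 - δ) < DODROM.sampleLaw Θ' N S ∧
            ∀ ν ∈ S,
              ∃ (θ : (archDOD (DODROM.reducedDim Θ Θ' T G u (A ν) ν ε)).Weights)
                (η : (archDF (DODROM.reducedDim Θ Θ' T G u (A ν) ν ε)).Weights),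
                (∀ μ ∈ Θ, ∀ t ∈ Icc 0 T,
                  DODROM.GOrthonormal G (A ν * θ.realize (Fin.append μ ![t]))) ∧
                DODROM.relativeError Θ Θ' T G u (DODROM.dodDfnn (A ν) θ η)
                  < ENNReal.ofReal ε := by
  obtain ⟨R, hR, hRΘ, hRΘ', hRT⟩ : ∃ R : ℝ, 0 < R ∧ (∀ μ ∈ Θ, ‖μ‖ ≤ R) ∧ (∀ ν ∈ Θ', ‖ν‖ ≤ R) ∧
      T ≤ R := by
    obtain ⟨R₁, h₁⟩ := hΘ.isBounded.exists_norm_le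
    obtain ⟨R₂, h₂⟩ := hΘ'.isBounded.exists_norm_le
    exact ⟨max T (max R₁ R₂), lt_max_of_lt_left hT,
      fun μ hμ => (h₁ μ hμ).trans ((le_max_left _ _).trans (le_max_right _ _)),
      fun ν hν => (h₂ ν hν).trans ((le_max_right _ _).trans (le_max_right _ _)), le_max_left _ _⟩
  have hRI : ∀ t ∈ Icc 0 T, |t| ≤ R := fun t ht => by
    rw [abs_of_nonneg ht.1]
    exact ht.2.trans hRT
  obtain ⟨C₁, hC₁, H₁⟩ := exists_architecture_lipschitz_two p hR
  obtain ⟨C₂, hC₂, H₂⟩ := exists_architecture_lipschitz_three p q hR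
  set M : ℝ := m + L * (5 * R) with hM_def
  have hM0 : 0 < M := by positivity
  have hV : 0 < volume.real Θ := ENNReal.toReal_pos hΘ_vol.ne' hΘ.measure_lt_top.ne
  have hV' : 0 < volume.real Θ' := ENNReal.toReal_pos hΘ_vol'.ne' hΘ'.measure_lt_top.ne
  set V : ℝ := volume.real Θ * volume.real Θ' * T with hV_def
  have hV0 : 0 < V := by positivity
  -- each of the two networks may contribute `α ε` to the error
  set α : ℝ := m / (8 * (V + 1)) with hα_def
  have hα : 0 < α := by positivity
  have hαV : 32 * α ^ 2 * V ≤ m ^ 2 := by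
    rw [hα_def, div_pow, mul_div_assoc', div_mul_eq_mul_div, div_le_iff₀ (by positivity)]
    have : 0 < m ^ 2 := by positivity
    nlinarith [mul_pos this hV0, mul_pos (mul_pos this hV0) hV0]
  have hQ₁ : ∀ n : ℕ, ∃ κ ∈ Ioc (0 : ℝ) 1,
      8 ^ n * (Lhat * (2 * (p + 2))) * (1 + 2 * n * M) * κ ≤ min α (1 / 2) := fun n =>
    exists_scale (by positivity) (lt_min hα (by norm_num))
  choose κ₁ hκ₁ hκ₁' using hQ₁
  obtain ⟨κ₂, hκ₂, hκ₂'⟩ := exists_scale (Q := (Lhat * M + L) * (2 * (p + q + 2))) (b := α)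
    (by positivity) hα
  have hℓ : 0 < Real.log ε₀⁻¹ := Real.log_pos ((one_lt_inv₀ hε₀.1).2 hε₀.2)
  set ℓ := Real.log ε₀⁻¹ with hℓ_def
  let k₁ : ℕ → ℝ := fun n => 2 * ((p + 1) + C₁ * (κ₁ n)⁻¹ ^ (p + 1))
  let k₂ : ℝ := C₂ * κ₂⁻¹ ^ (p + q + 1)
  have hk₁ : ∀ n, 0 < k₁ n := fun n => by
    have := (hκ₁ n).1
    positivity
  have hk₂ : 0 < k₂ := by
    have := hκ₂.1
    positivity
  refine ⟨fun n => (5 + k₁ n + k₂) / ℓ, fun n => by have := hk₁ n; positivity, ?_⟩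
  intro Nh NA hNA G _ u hu hmu ε hε δ hδ
  subst hNA
  have hNA : (1 : ℝ) ≤ NA := by
    exact_mod_cast dim_pos_of_essInf hΘ_vol hΘ_vol' hT (hmu ▸ hm)
  have hε0 : 0 < ε := hε.1
  have hε1 : ε ≤ 1 := hε.2.trans hε₀.2.le
  have hεinv : 1 ≤ ε⁻¹ := (one_le_inv₀ hε0).2 hε1
  have hlog : ℓ ≤ Real.log ε⁻¹ :=
    Real.log_le_log (inv_pos.2 hε₀.1) (inv_anti₀ hε0 hε.2)
  -- the logarithm in the complexity bounds absorbs the division by `ℓ`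
  have habsorb : ∀ n : ℕ, ∀ k X : ℝ, 0 ≤ X → k ≤ 5 + k₁ n + k₂ →
      k * X ≤ (5 + k₁ n + k₂) / ℓ * X * Real.log ε⁻¹ := by
    intro n k X hX hk
    have h5 : 0 ≤ 5 + k₁ n + k₂ := by have := hk₁ n; positivity
    calc k * X ≤ (5 + k₁ n + k₂) * X := mul_le_mul_of_nonneg_right hk hX
      _ = (5 + k₁ n + k₂) / ℓ * X * ℓ := by field_simp
      _ ≤ _ := mul_le_mul_of_nonneg_left hlog (by positivity)
  have hscale : ∀ κ ∈ Ioc (0 : ℝ) 1, κ * ε ∈ Ioc (0 : ℝ) 1 := fun κ hκ =>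
    ⟨mul_pos hκ.1 hε0, mul_le_one₀ hκ.2 hε0.le hε1⟩
  choose a₁ ha₁d ha₁w ha₁ using fun n => H₁ (κ₁ n * ε) (hscale _ (hκ₁ n)) NA
  choose a₂ ha₂d ha₂w ha₂ using fun n => H₂ (κ₂ * ε) (hscale _ hκ₂) n
  obtain ⟨aid, haidd, haidw, θid, hθid⟩ := exists_idNetwork (p + 1)
  set ζ : ℝ := m ^ 2 / (16 * (volume.real Θ * T)) * ε ^ 2 with hζ_def
  have hζ : 0 < ζ := by positivity
  have : IsProbabilityMeasure (ProbabilityTheory.cond volume Θ') :=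
    ProbabilityTheory.cond_isProbabilityMeasure_of_finite hΘ_vol'.ne' hΘ'.measure_lt_top.ne
  have hcond : ProbabilityTheory.cond volume Θ' Θ'ᶜ = 0 := by
    rw [ProbabilityTheory.cond_apply hΘ'.measurableSet, inter_compl_self, measure_empty, mul_zero]
  obtain ⟨N₀, -, hN₀⟩ := exists_uniform_sample_bound (ProbabilityTheory.cond volume Θ') hΘ' hcond
    (B := M ^ 2) (Λ := 2 * M * L) (τ := ζ / volume.real Θ') (by positivity) (by positivity)
    (by positivity) hδ.1
  refine ⟨N₀, fun n => ⟨p + 1, aid, fun _ => a₁ n⟩, a₂, fun n => ⟨?_, ?_, ?_, ?_⟩, ?_⟩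
  · have h : (DODArchitecture.layers ⟨p + 1, aid, fun _ : Fin n => a₁ n⟩ : ℝ) ≤ 5 * 1 := by
      have : DODArchitecture.layers ⟨p + 1, aid, fun _ : Fin n => a₁ n⟩ ≤ 1 + 4 :=
        add_le_add haidd.le (Finset.sup_le fun _ _ => ha₁d n)
      norm_num
      exact_mod_cast this
    refine h.trans ((habsorb n 5 1 zero_le_one ?_).trans_eq (by rw [mul_one]))
    have := hk₁ n
    linarith
  · have h : (DODArchitecture.activeWeights ⟨p + 1, aid, fun _ : Fin n => a₁ n⟩ : ℝ) =
        n * (2 * ((p + 1) + (a₁ n).activeWeights)) := by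
      simp [DODArchitecture.activeWeights, haidw]
    rw [h]
    have hw := ha₁w n
    rw [mul_inv, mul_pow] at hw
    have hpow : (1 : ℝ) ≤ ε⁻¹ ^ (p + 1) := one_le_pow₀ hεinv
    have hX : (1 : ℝ) ≤ NA * ε⁻¹ ^ (p + 1) := one_le_mul_of_one_le_of_one_le hNA hpow
    calc (n : ℝ) * (2 * ((p + 1) + (a₁ n).activeWeights))
        ≤ n * (2 * ((p + 1) * (NA * ε⁻¹ ^ (p + 1)) +
            C₁ * NA * ((κ₁ n)⁻¹ ^ (p + 1) * ε⁻¹ ^ (p + 1)))) := by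
          gcongr
          exact le_mul_of_one_le_right (by positivity) hX
      _ = k₁ n * (NA * n * ε⁻¹ ^ (p + 1)) := by
          simp only [k₁]
          ring
      _ ≤ (5 + k₁ n + k₂) / ℓ * (NA * n * ε⁻¹ ^ (p + 1)) * Real.log ε⁻¹ :=
          habsorb n _ _ (by positivity) (by linarith)
      _ = _ := by ring
  · have h : ((a₂ n).depth : ℝ) ≤ 5 * 1 := by
      have : (a₂ n).depth ≤ 5 := (ha₂d n).trans (by norm_num)
      norm_num
      exact_mod_cast this
    refine h.trans ((habsorb n 5 1 zero_le_one ?_).trans_eq (by rw [mul_one]))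
    have := hk₁ n
    linarith
  · have hw := ha₂w n
    rw [mul_inv, mul_pow] at hw
    calc ((a₂ n).activeWeights : ℝ) ≤ k₂ * (n * ε⁻¹ ^ (p + q + 1)) := by
          refine hw.trans_eq ?_
          simp only [k₂]
          ring
      _ ≤ (5 + k₁ n + k₂) / ℓ * (n * ε⁻¹ ^ (p + q + 1)) * Real.log ε⁻¹ :=
          habsorb n _ _ (by positivity) (by have := hk₁ n; linarith)
      _ = _ := by ring
  · intro N hN A hA hopt
    obtain ⟨S₀, hS₀m, hS₀, hS₀'⟩ := hN₀ N hN
    have : IsProbabilityMeasure (sampleLaw Θ' N) := by unfold sampleLaw; infer_instance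
    obtain ⟨S, hSm, hS, hS'⟩ := exists_measurableSet_of_ae (sampleLaw Θ' N) hδ hS₀m hS₀ hopt
    refine ⟨S, hSm, hS, fun ν hνS => ?_⟩
    obtain ⟨hνS₀, s, hs, hsL⟩ := hS' ν hνS
    obtain ⟨-, hν⟩ := hS₀' ν hνS₀
    obtain ⟨hn, htail⟩ := reducedDim_spec Θ Θ' hT.le G (A ν) u ν ε
    generalize reducedDim Θ Θ' T G u (A ν) ν ε = n at s hs hsL hn htail ⊢
    have hMu : ∀ μ ∈ Θ, ∀ ν' ∈ Θ', ∀ t ∈ Icc 0 T, gNorm G (u μ ν' t) ≤ M := by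
      intro μ hμ ν' hν' t ht
      rw [hM_def, ← hmu]
      exact gNorm_le_of_lipschitz (hA ν) hΘ hΘ' hΘ_vol hΘ_vol' hT hL.le hu hRΘ hRΘ' hRT hμ hν' ht
    choose θ hθ using fun j => ha₁ n Θ (Icc 0 T) (fun μ t => euclideanCol (s μ t) j) Lhat hLhat.le
      hRΘ hRI (fun μ₁ h₁ μ₂ h₂ t₁ ht₁ t₂ ht₂ => hsL.norm_col_sub_le h₁ h₂ ht₁ ht₂ j)
    obtain ⟨ω, hω⟩ := ha₂ n Θ Θ' (Icc 0 T) (fun μ ν' t => WithLp.toLp 2 fun j =>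
        inner ℝ (euclideanCol (s μ t) j) (coords G (A ν) u μ ν' t)) (Lhat * M + L) (by positivity)
      hRΘ hRΘ' hRI (norm_coefficients_lipschitz (hA ν) hLhat.le hu hMu hs hsL)
    set η : ℝ := Lhat * (2 * (p + 2) * (κ₁ n * ε)) with hη_def
    have hκ0 := (hκ₁ n).1
    have hη : 0 ≤ η := by positivity
    -- the two requirements on the scale of the root networks
    have hη8 : 8 ^ n * η * (1 + 2 * n * M) ≤ min α (1 / 2) * ε := by
      calc 8 ^ n * η * (1 + 2 * n * M) =
          8 ^ n * (Lhat * (2 * (p + 2))) * (1 + 2 * n * M) * κ₁ n * ε := by rw [hη_def]; ring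
        _ ≤ _ := mul_le_mul_of_nonneg_right (hκ₁' n) hε0.le
    have hη1 : 8 ^ n * η < 1 := by
      have h1 : 8 ^ n * η ≤ 8 ^ n * η * (1 + 2 * n * M) :=
        le_mul_of_one_le_right (by positivity) (by
          have : 0 ≤ 2 * (n : ℝ) * M := by positivity
          linarith)
      have h2 : min α (1 / 2) * ε ≤ 1 / 2 * 1 :=
        mul_le_mul (min_le_right _ _) hε1 hε0.le (by norm_num)
      linarith
    have hηα : n * (2 * 8 ^ n * η * M) ≤ α * ε := by
      have h1 : n * (2 * 8 ^ n * η * M) ≤ 8 ^ n * η * (1 + 2 * n * M) := by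
        have : 0 ≤ 8 ^ n * η := by positivity
        linarith
      have h2 : min α (1 / 2) * ε ≤ α * ε := mul_le_mul_of_nonneg_right (min_le_left _ _) hε0.le
      linarith
    have hβα : (Lhat * M + L) * (2 * (p + q + 2) * (κ₂ * ε)) ≤ α * ε := by
      calc _ = (Lhat * M + L) * (2 * (p + q + 2)) * κ₂ * ε := by ring
        _ ≤ _ := mul_le_mul_of_nonneg_right hκ₂' hε0.le
    let Ψ : (DODArchitecture.mk (p + 1) aid fun _ : Fin n => a₁ n).Weights := ⟨θid, θ⟩
    have hΨ : ∀ μ ∈ Θ, ∀ t ∈ Icc 0 T, Orthonormal ℝ (euclideanCol (Ψ.realize (Fin.append μ ![t]))) ∧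
        ∀ j, ‖euclideanCol (Ψ.realize (Fin.append μ ![t])) j - euclideanCol (s μ t) j‖ ≤
          2 * 8 ^ n * η := by
      intro μ hμ t ht
      refine Ψ.realize_close (hA ν) hs hη hη1 hμ ht fun j => ?_
      change ‖WithLp.toLp 2 ((θ j).realize (θid.realize (Fin.append μ ![t]))) - _‖ ≤ η
      rw [hθid]
      exact hθ j μ hμ t ht
    refine ⟨Ψ, ω, fun μ hμ t ht => (gOrthonormal_mul_iff (hA ν) _).2
      ((orthonormal_euclideanCol_iff _).1 (hΨ μ hμ t ht).1), ?_⟩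
    refine relativeError_lt hΘ hΘ' hΘ_vol hT (b := 2 * α * ε) hm hε0 hmu
      (projError G (A ν) u s) ?_ ?_ ?_
    · intro μ hμ ν' hν' t ht
      unfold dodDfnn
      refine (gNorm_sub_mulVec_le (hA ν) (Ψ.realize (Fin.append μ ![t])) _ (hMu μ hμ ν' hν' t ht)
        (hs.orthonormal (hA ν) hμ ht) (hΨ μ hμ t ht).1 (hΨ μ hμ t ht).2
        (hω μ hμ ν' hν' t ht)).trans ?_
      linarith
    · intro μ hμ t ht
      rw [hmu] at htail
      refine (lintegral_projError_le (hA ν) hΘ' hΘ_vol' hu hMu hs hn htail ?_ hν hμ ht).trans_eq ?_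
      · rw [mul_div_cancel₀ _ hV'.ne']
      · congr 1
        field_simp
        norm_num
    · have := mul_le_mul_of_nonneg_right hαV (sq_nonneg ε)
      calc _ = 32 * α ^ 2 * V * ε ^ 2 := by ring
        _ ≤ _ := this
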